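/- For integers $k,m\ge 1$ put $n=2km$, $\theta=\pi/k$, $\delta=n^{-4}$. Let $S_0\subset\mathbb{R}^2$ consist of the points $x_i^{\pm}=(\pm\tfrac12,\,i\delta)$, $i=1,\dots,m$, let $S_j$ be $S_0$ rotated about the origin by the angle $j\theta$ for $0\le j\le k-1$, and let $S=S_0\cup\dots\cup S_{k-1}$, a set of $n$ points. Let $\mathcal{R}_1(S)$ be the Rips complex at scale $1$, the abstract simplicial complex on the vertex set $S$ whose simplices are the nonempty subsets of $S$ any two of whose points are at distance at most $1$. For $d\ge 0$ let $\Delta_d=\partial_d^{\dagger}\partial_d+\partial_{d+1}\partial_{d+1}^{\dagger}$ be its combinatorial Laplacian on real $d$-chains, where $\partial_0=0$ and the simplices form an orthonormal basis, and let the spectral gap $\lambda_{\min}(\Delta_d)$ be the smallest nonzero eigenvalue of $\Delta_d$. Then there is an absolute constant $c>0$ such that for every $k\ge 1$: (1) for all $m\ge 1$ and all $d\ge 0$, every nonzero eigenvalue of $\Delta_d$ is at least $c$; (2) for every $d$ with $k\le d\le 2k-1$ (in particular for $d=k$ and for $d=2k-1$), the spectral gap $\lambda_{\min}(\Delta_d)$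 exists and has the same value for all $m\ge 2$, that is, it does not depend on $n=2km$. -/

import Mathlib

noncomputable section

/-! ### Simplicial chains and the combinatorial Laplacian -/

/-- The `d`-simplices of an abstract simplicial complex: its faces with `d + 1` vertices. -/
def AbstractSimplicialComplex.Simplex {V : Type*} (K : AbstractSimplicialComplex V) (d : ℕ) :
    Type _ :=
  {σ : Finset V // σ ∈ K ∧ σ.card = d + 1}

instance AbstractSimplicialComplex.Simplex.instDecidableEq {V : Type*} [DecidableEq V]
    (K : AbstractSimplicialComplex V) (d : ℕ) : DecidableEq (K.Simplex d) :=
  inferInstanceAs (DecidableEq {σ : Finset V // σ ∈ K ∧ σ.card = d + 1})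

instance AbstractSimplicialComplex.Simplex.instFinite {V : Type*} [Finite V]
    (K : AbstractSimplicialComplex V) (d : ℕ) : Finite (K.Simplex d) :=
  inferInstanceAs (Finite {σ : Finset V // σ ∈ K ∧ σ.card = d + 1})

instance AbstractSimplicialComplex.Simplex.instFintype {V : Type*} [Finite V]
    (K : AbstractSimplicialComplex V) (d : ℕ) : Fintype (K.Simplex d) :=
  Fintype.ofFinite _

/-- The coefficient of `τ` in the boundary of `σ = [v₀, …, v_d]`, `v₀ < ⋯ < v_d`: it is `(-1) ^ i`
if `τ` is `σ` with `v_i` removed, and `0` if `τ` is not of this form. The position `i` of a vertex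
is the number of vertices of `σ` below it. -/
def boundaryCoeff {V : Type*} [LinearOrder V] (τ σ : Finset V) : ℝ :=
  ∑ v ∈ σ, if τ = σ.erase v then (-1) ^ (σ.filter (· < v)).card else 0

/-- The matrix of the boundary map `∂_{d+1} : C_{d+1} → C_d` in the bases of simplices. -/
def AbstractSimplicialComplex.boundary {V : Type*} [LinearOrder V]
    (K : AbstractSimplicialComplex V) (d : ℕ) : Matrix (K.Simplex d) (K.Simplex (d + 1)) ℝ :=
  Matrix.of fun τ σ => boundaryCoeff τ.1 σ.1

open scoped Matrix in
/-- The combinatorial Laplacian `Δ_d = ∂_d† ∂_d + ∂_{d+1} ∂_{d+1}†`, as a matrix in the orthonormal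
basis of `d`-simplices (with `∂_0 = 0`). -/
def AbstractSimplicialComplex.laplacian {V : Type*} [LinearOrder V] [Finite V]
    (K : AbstractSimplicialComplex V) : (d : ℕ) → Matrix (K.Simplex d) (K.Simplex d) ℝ
  | 0 => K.boundary 0 * (K.boundary 0)ᵀ
  | d + 1 => (K.boundary d)ᵀ * K.boundary d + K.boundary (d + 1) * (K.boundary (d + 1))ᵀ

/-- The nonzero real eigenvalues of a square matrix. -/
def nonzeroEigenvalues {α : Type*} [Fintype α] [DecidableEq α] (A : Matrix α α ℝ) : Set ℝ :=
  {μ | μ ≠ 0 ∧ Module.End.HasEigenvalue (Matrix.toLin' A) μ}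

/-- `l` is the spectral gap `λ_min` of `A`: its smallest nonzero eigenvalue. -/
def IsSpectralGap {α : Type*} [Fintype α] [DecidableEq α] (A : Matrix α α ℝ) (l : ℝ) : Prop :=
  IsLeast (nonzeroEigenvalues A) l

/-! ### Rips complexes -/

/-- The Vietoris-Rips complex at scale `ε`: the faces are the nonempty finite sets of points any two
of which are within distance `ε`. -/
def ripsComplex (X : Type*) [MetricSpace X] (ε : ℝ) : AbstractSimplicialComplex X where
  faces := {σ | σ.Nonempty ∧ (σ : Set X).Pairwise fun x y => dist x y ≤ ε}
  isRelLowerSet_faces := fun _ hσ =>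
    ⟨hσ.1, fun _ hle hne => ⟨hne, hσ.2.mono (Finset.coe_subset.2 hle)⟩⟩
  singleton_mem := fun v => ⟨Finset.singleton_nonempty v, by simp⟩

/-! ### The planar point set -/

/-- The point `(a, b)` of the plane rotated about the origin by the angle `φ`. -/
def rotatedPoint (φ a b : ℝ) : EuclideanSpace ℝ (Fin 2) :=
  !₂[Real.cos φ * a - Real.sin φ * b, Real.sin φ * a + Real.cos φ * b]

/-- With `n = 2km` and `δ = n⁻⁴`, the point with label `(j, s, i)`, for `0 ≤ j < k`, a sign
`s ∈ {0, 1}` and `0 ≤ i < m`, is `((-1)^s / 2, (i + 1) δ)` rotated by the angle `j π / k`.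
The labels are ordered lexicographically. -/
def planarPoint (k m : ℕ) (v : Fin k ×ₗ Fin 2 ×ₗ Fin m) : EuclideanSpace ℝ (Fin 2) :=
  let j := (ofLex v).1
  let s := (ofLex (ofLex v).2).1
  let i := (ofLex (ofLex v).2).2
  rotatedPoint ((j : ℕ) * (Real.pi / k)) ((-1) ^ (s : ℕ) * (1 / 2))
    (((i : ℕ) + 1) * ((2 * k * m : ℝ) ^ 4)⁻¹)

/-- The point set `S`, a union of `k` rotated copies of two clusters of `m` points. -/
def planarSet (k m : ℕ) : Set (EuclideanSpace ℝ (Fin 2)) :=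
  Set.range (planarPoint k m)

instance planarSet.instFinite (k m : ℕ) : Finite (planarSet k m) :=
  inferInstanceAs (Finite (Set.range (planarPoint k m)))

/-- The points of `S` are ordered as they are listed. The order only fixes orientations of simplices,
so the spectra of the Laplacians do not depend on it. -/
instance planarSet.instLinearOrder (k m : ℕ) : LinearOrder (planarSet k m) :=
  LinearOrder.lift' (Set.rangeSplitting (planarPoint k m)) (Set.rangeSplitting_injective _)

/-- The Rips complex `R₁(S)`. -/
def planarRips (k m : ℕ) : AbstractSimplicialComplex (planarSet k m) :=
  ripsComplex (planarSet k m) 1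

end

/-!
The point set is a union of `2k` clusters. Points of different clusters are at distance at most `1`
except for two points of opposite clusters that have different heights: a rotation by a nontrivial
multiple of `π / k` shortens the distance between two antipodal points by about `1 / k²`, far more
than the diameter of the clusters, whereas in opposite clusters the distance is `√(1 + h²)` with
`h` the difference of the heights. Since all conditions concern pairs of opposite clusters, the Rips
complex is the join of `k` copies of one block: two simplices on `m` vertices each, joined by a
perfect matching.

Count the empty set as a face. The chains of a join are then the tensor product of the chains of the
factors, and the Laplacian is the sum of the Laplacians of the factors
(`augLaplacian_mulVec_eq_blocks`), because the boundary maps of different factors anticommute with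
each other and with each other's transposes (`sum_signedFactorOp_anticommutator`). The vertices are
ordered block by block, so the signs of the tensor product are those of `boundaryCoeff`. Hence the
eigenvalues are the sums of eigenvalues of the block, one for each factor, taken in sizes that add
up to `d + 1` (`exists_of_mem_nonzeroEigenvalues`, `sum_mem_nonzeroEigenvalues`).

The eigenvalues of the block (`blockEigenvalue`) are `2m` on the empty set, and `2`, `m`, `m + 2`,
`2m` on vertices; they are `m` on faces with at least three vertices. On edges a nonzero eigenvalue
also occurs on vertices or on triangles, by the Hodge decomposition, and `0` occurs when `m ≥ 2`
(`exists_blockEigenvector_harmonic`). So every nonzero eigenvalue of `Δ_d` is at least `1`, and for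
`m ≥ 2` at least `2`. For `m ≥ 2` a block eigenvalue in size `e` is also at least `4 - 2e`, so an
eigenvalue of `Δ_d` is at least `4k - 2(d + 1) = 2t` with `t = 2k - 1 - d`. The larger of the bounds
`2` and `2t` is attained, by eigenvalues `2` on `max 1 t` factors and harmonic chains on edges
elsewhere. When `t ≥ 1` the factors with eigenvalue `2` are in size one, and when `t = 0` the single
one is in size two.
-/

noncomputable section

open Finset Matrix

/-! ### Augmented complexes and their Laplacians -/

section AugmentedComplex

variable {V : Type*} [LinearOrder V]

/-- The sign `(-1) ^ i` where `i` is the number of vertices of `σ` below `v`. -/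
def vertexSign (σ : Finset V) (v : V) : ℝ :=
  (-1) ^ (σ.filter (· < v)).card

lemma vertexSign_mul_self (σ : Finset V) (v : V) : vertexSign σ v * vertexSign σ v = 1 := by
  unfold vertexSign
  rw [← mul_pow]; norm_num

lemma vertexSign_insert_self (σ : Finset V) (v : V) :
    vertexSign (insert v σ) v = vertexSign σ v := by
  simp [vertexSign, filter_insert]

lemma vertexSign_erase_self (σ : Finset V) (v : V) :
    vertexSign (σ.erase v) v = vertexSign σ v := by
  unfold vertexSign
  congr 2
  ext w
  simp only [mem_filter, mem_erase]
  exact ⟨fun h => ⟨h.1.2, h.2⟩, fun h => ⟨⟨h.2.ne, h.1⟩, h.2⟩⟩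

lemma vertexSign_insert {σ : Finset V} {u : V} (hu : u ∉ σ) (v : V) :
    vertexSign (insert u σ) v = (if u < v then -1 else 1) * vertexSign σ v := by
  unfold vertexSign
  rw [filter_insert]
  split_ifs with h
  · rw [card_insert_of_notMem (by simp [hu]), pow_succ]; ring
  · simp

lemma vertexSign_insert_swap {σ : Finset V} {u v : V} (hu : u ∉ σ) (hv : v ∉ σ) (huv : u ≠ v) :
    vertexSign σ u * vertexSign (insert u σ) v = -(vertexSign σ v * vertexSign (insert v σ) u) := by
  rw [vertexSign_insert hu, vertexSign_insert hv]
  rcases lt_or_gt_of_ne huv with h | h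
  · simp [h, h.not_gt]; ring
  · simp [h, h.not_gt]; ring

/-- The two ways of replacing the vertex `v` of `σ` by `u`, through `σ ∪ {u}` and through
`σ \ {v}`, carry opposite signs. -/
lemma vertexSign_exchange {σ : Finset V} {u v : V} (hv : v ∈ σ) (hu : u ∉ σ) :
    vertexSign σ u * vertexSign (insert u σ) v =
      -(vertexSign σ v * vertexSign (σ.erase v) u) := by
  have huv : u ≠ v := fun h => hu (h ▸ hv)
  have h1 : u ∉ σ.erase v := fun h => hu (mem_of_mem_erase h)
  have h2 : vertexSign σ u = (if v < u then -1 else 1) * vertexSign (σ.erase v) u := by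
    conv_lhs => rw [← insert_erase hv]
    exact vertexSign_insert (notMem_erase v σ) u
  rw [vertexSign_insert hu, h2]
  rcases lt_or_gt_of_ne huv with h | h
  · simp [h, h.not_gt]; ring
  · simp [h, h.not_gt]; ring

variable [Fintype V]

open scoped Classical in
/-- The boundary map of the augmented complex whose faces are the sets satisfying `P`, the empty
set among them; `P` is meant to be inherited by subsets. The matrix acts on functions on all finite
sets of vertices, and ignores the values at sets that are not faces. -/
def augBoundary (P : Finset V → Prop) : Matrix (Finset V) (Finset V) ℝ :=
  Matrix.of fun τ σ => if P σ then boundaryCoeff τ σ else 0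

/-- The Laplacian of the augmented complex of the sets satisfying `P`, in all degrees at once. -/
def augLaplacian (P : Finset V → Prop) : Matrix (Finset V) (Finset V) ℝ :=
  augBoundary P * (augBoundary P)ᵀ + (augBoundary P)ᵀ * augBoundary P

lemma augLaplacian_isHermitian (P : Finset V → Prop) : (augLaplacian P).IsHermitian := by
  unfold augLaplacian Matrix.IsHermitian
  simp [Matrix.conjTranspose_eq_transpose_of_trivial, Matrix.transpose_mul]

open scoped Classical in
lemma augBoundary_mulVec (P : Finset V → Prop) (f : Finset V → ℝ) (σ : Finset V) :
    (augBoundary P *ᵥ f) σ =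
      ∑ v ∈ σᶜ, if P (insert v σ) then vertexSign σ v * f (insert v σ) else 0 := by
  have h1 : (augBoundary P *ᵥ f) σ = ∑ τ : Finset V, ∑ v : V,
      if v ∈ τ ∧ σ = τ.erase v ∧ P τ then vertexSign τ v * f τ else 0 := by
    simp only [mulVec, dotProduct, augBoundary, of_apply, boundaryCoeff]
    refine sum_congr rfl fun τ _ => ?_
    by_cases hP : P τ
    · simp only [hP, if_true, sum_mul, and_true, ite_and]
      rw [← sum_filter]
      refine sum_congr (by ext; simp) fun v _ => ?_
      split_ifs <;> simp [vertexSign]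
    · simp [hP]
  rw [h1, sum_comm]
  rw [← sum_subset (subset_univ σᶜ)]
  · refine sum_congr rfl fun v hv => ?_
    have hv : v ∉ σ := by simpa using hv
    rw [sum_eq_single (insert v σ)]
    · simp [hv, vertexSign_insert_self]
    · intro τ _ hτ
      rw [if_neg]
      rintro ⟨h1, h2, -⟩
      exact hτ (by rw [h2, insert_erase h1])
    · simp
  · intro v _ hv
    refine sum_eq_zero fun τ _ => ?_
    rw [if_neg]
    rintro ⟨h1, h2, -⟩
    apply hv
    rw [h2]; simp

open scoped Classical in
lemma augBoundary_transpose_mulVec (P : Finset V → Prop) (f : Finset V → ℝ) (σ : Finset V) :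
    ((augBoundary P)ᵀ *ᵥ f) σ =
      if P σ then ∑ v ∈ σ, vertexSign σ v * f (σ.erase v) else 0 := by
  simp only [mulVec, dotProduct, augBoundary, transpose_apply, of_apply, boundaryCoeff]
  split_ifs
  · simp only [sum_mul]
    rw [sum_comm]
    refine sum_congr rfl fun v _ => ?_
    simp [vertexSign]
  · simp

lemma augBoundary_mul_self {P : Finset V → Prop} (hP : ∀ σ τ, τ ⊆ σ → P σ → P τ) :
    augBoundary P * augBoundary P = 0 := by
  classical
  apply Matrix.ext_of_mulVec_single
  intro i
  rw [← mulVec_mulVec, zero_mulVec]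
  generalize (Pi.single i (1 : ℝ) : Finset V → ℝ) = f
  ext σ
  rw [augBoundary_mulVec]
  set T : V → V → ℝ := fun u v =>
    if u ∉ σ ∧ v ∉ σ ∧ u ≠ v ∧ P (insert v (insert u σ)) then
      vertexSign σ u * (vertexSign (insert u σ) v * f (insert v (insert u σ))) else 0 with hT
  have h1 : (∑ u ∈ σᶜ, if P (insert u σ) then
      vertexSign σ u * (augBoundary P *ᵥ f) (insert u σ) else 0) = ∑ u, ∑ v, T u v := by
    rw [← sum_subset (subset_univ σᶜ)]
    · refine sum_congr rfl fun u hu => ?_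
      have hu : u ∉ σ := by simpa using hu
      rw [augBoundary_mulVec]
      split_ifs with hPu
      · rw [mul_sum, ← sum_subset (subset_univ (insert u σ)ᶜ)]
        · refine sum_congr rfl fun v hv => ?_
          have hv : v ≠ u ∧ v ∉ σ := by simpa using hv
          simp only [hT, hu, hv.2, hv.1.symm, not_false_eq_true, true_and, ne_eq]
          split_ifs <;> simp
        · intro v _ hv
          simp only [hT]
          rw [if_neg]
          rintro ⟨-, h2, h3, -⟩
          exact hv (by simp [h2, h3.symm])
      · refine (sum_eq_zero fun v _ => ?_).symm
        simp only [hT]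
        rw [if_neg]
        rintro ⟨-, -, -, h⟩
        exact hPu (hP _ _ (subset_insert _ _) h)
    · intro u _ hu
      refine sum_eq_zero fun v _ => ?_
      simp only [hT]
      rw [if_neg]
      rintro ⟨h, -⟩
      exact hu (by simpa using h)
  have h2 : ∑ u, ∑ v, T u v = -∑ u, ∑ v, T u v := by
    conv_lhs => rw [sum_comm]
    rw [← sum_neg_distrib]
    refine sum_congr rfl fun u _ => ?_
    rw [← sum_neg_distrib]
    refine sum_congr rfl fun v _ => ?_
    simp only [hT]
    by_cases h : u ∉ σ ∧ v ∉ σ ∧ u ≠ v ∧ P (insert v (insert u σ))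
    · rw [if_pos h, if_pos ⟨h.2.1, h.1, h.2.2.1.symm, by rw [insert_comm]; exact h.2.2.2⟩,
        ← mul_assoc, ← mul_assoc, vertexSign_insert_swap h.2.1 h.1 h.2.2.1.symm,
        insert_comm v u]
      ring
    · rw [if_neg h, if_neg, neg_zero]
      rintro ⟨h1, h2, h3, h4⟩
      exact h ⟨h2, h1, h3.symm, by rw [insert_comm]; exact h4⟩
  rw [h1, Pi.zero_apply]
  linarith

open scoped Classical in
/-- The Laplacian of a complex: the coefficients at two faces `σ` and `σ \ {v} ∪ {u}` cancel
unless `σ ∪ {u}` fails to be a face. -/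
lemma augLaplacian_mulVec {P : Finset V → Prop} (hP : ∀ σ τ, τ ⊆ σ → P σ → P τ)
    (f : Finset V → ℝ) {σ : Finset V} (hσ : P σ) :
    (augLaplacian P *ᵥ f) σ =
      ((σ.card : ℝ) + (σᶜ.filter fun u => P (insert u σ)).card) * f σ +
      ∑ v ∈ σ, ∑ u ∈ σᶜ, if P (insert u (σ.erase v)) ∧ ¬ P (insert u σ) then
        vertexSign σ v * vertexSign (σ.erase v) u * f (insert u (σ.erase v)) else 0 := by
  rw [augLaplacian, add_mulVec, Pi.add_apply, ← mulVec_mulVec, ← mulVec_mulVec,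
    augBoundary_mulVec, augBoundary_transpose_mulVec, if_pos hσ]
  have h1 : (∑ u ∈ σᶜ, if P (insert u σ) then
      vertexSign σ u * ((augBoundary P)ᵀ *ᵥ f) (insert u σ) else 0) =
      ((σᶜ.filter fun u => P (insert u σ)).card : ℝ) * f σ -
      ∑ v ∈ σ, ∑ u ∈ σᶜ, if P (insert u σ) then
        vertexSign σ v * vertexSign (σ.erase v) u * f (insert u (σ.erase v)) else 0 := by
    rw [card_filter]
    push_cast
    rw [sum_mul, sum_comm, ← sum_sub_distrib]
    refine sum_congr rfl fun u hu => ?_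
    have hu : u ∉ σ := by simpa using hu
    rw [augBoundary_transpose_mulVec]
    split_ifs with h
    · rw [sum_insert hu, erase_insert hu, vertexSign_insert_self, mul_add, ← mul_assoc,
        vertexSign_mul_self, sub_eq_add_neg, mul_sum, ← sum_neg_distrib]
      congr 1
      refine sum_congr rfl fun v hv => ?_
      have huv : u ≠ v := fun h => hu (by rwa [h])
      rw [← mul_assoc, vertexSign_exchange hv hu, erase_insert_of_ne huv]
      ring
    · simp
  have h2 : ∑ v ∈ σ, vertexSign σ v * (augBoundary P *ᵥ f) (σ.erase v) =
      (σ.card : ℝ) * f σ +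
      ∑ v ∈ σ, ∑ u ∈ σᶜ, if P (insert u (σ.erase v)) then
        vertexSign σ v * vertexSign (σ.erase v) u * f (insert u (σ.erase v)) else 0 := by
    rw [card_eq_sum_ones]
    push_cast
    rw [sum_mul, ← sum_add_distrib]
    refine sum_congr rfl fun v hv => ?_
    rw [augBoundary_mulVec, compl_erase, sum_insert (by simpa using hv), insert_erase hv,
      if_pos hσ, mul_add, ← mul_assoc, vertexSign_erase_self, vertexSign_mul_self, mul_sum]
    congr 1
    refine sum_congr rfl fun u _ => ?_
    split_ifs <;> ring
  rw [h1, h2, add_mul, sub_add_eq_add_sub, sub_eq_iff_eq_add, add_assoc, add_assoc,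
    ← sum_add_distrib, ← add_assoc, ← add_assoc, add_comm (_ * f σ) (_ * f σ)]
  congr 1
  refine sum_congr rfl fun v hv => ?_
  rw [← sum_add_distrib]
  refine sum_congr rfl fun u _ => ?_
  by_cases h : P (insert u σ)
  · simp [h, hP _ _ (insert_subset_insert u (erase_subset v σ)) h]
  · simp [h]

lemma augLaplacian_mulVec_of_not {P : Finset V → Prop} (hP : ∀ σ τ, τ ⊆ σ → P σ → P τ)
    (f : Finset V → ℝ) {σ : Finset V} (hσ : ¬ P σ) : (augLaplacian P *ᵥ f) σ = 0 := by
  rw [augLaplacian, add_mulVec, Pi.add_apply, ← mulVec_mulVec, ← mulVec_mulVec,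
    augBoundary_mulVec, augBoundary_transpose_mulVec, if_neg hσ, add_zero]
  exact sum_eq_zero fun u _ => if_neg fun h => hσ (hP _ _ (subset_insert _ _) h)

lemma augLaplacian_mul_augBoundary {P : Finset V → Prop} (hP : ∀ σ τ, τ ⊆ σ → P σ → P τ) :
    augLaplacian P * augBoundary P = augBoundary P * augLaplacian P := by
  rw [augLaplacian, add_mul, mul_add, ← mul_assoc (augBoundary P) (augBoundary P),
    augBoundary_mul_self hP, mul_assoc _ _ (augBoundary P), mul_assoc _ _ (augBoundary P),
    augBoundary_mul_self hP]
  simp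

lemma augLaplacian_mul_augBoundary_transpose {P : Finset V → Prop}
    (hP : ∀ σ τ, τ ⊆ σ → P σ → P τ) :
    augLaplacian P * (augBoundary P)ᵀ = (augBoundary P)ᵀ * augLaplacian P := by
  have h := congrArg Matrix.transpose (augLaplacian_mul_augBoundary hP)
  have hs : (augLaplacian P)ᵀ = augLaplacian P := by
    simpa [Matrix.IsHermitian, Matrix.conjTranspose_eq_transpose_of_trivial] using
      augLaplacian_isHermitian P
  rw [transpose_mul, transpose_mul, hs] at h
  exact h.symm

end AugmentedComplex

/-! ### Two simplices joined by a perfect matching -/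

section Block

variable {m : ℕ}

/-- The augmented faces of the complex of two simplices on `m` vertices each, joined by a perfect
matching: sets in which vertices of different simplices are matched. -/
def BlockFace (σ : Finset (Fin 2 ×ₗ Fin m)) : Prop :=
  ∀ u ∈ σ, ∀ v ∈ σ, (ofLex u).1 ≠ (ofLex v).1 → (ofLex u).2 = (ofLex v).2

lemma BlockFace.mono (σ τ : Finset (Fin 2 ×ₗ Fin m)) (h : τ ⊆ σ) (hσ : BlockFace σ) :
    BlockFace τ :=
  fun u hu v hv => hσ u (h hu) v (h hv)

lemma blockFace_empty : BlockFace (∅ : Finset (Fin 2 ×ₗ Fin m)) := by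
  simp [BlockFace]

lemma blockFace_singleton (v : Fin 2 ×ₗ Fin m) : BlockFace {v} := by
  simp [BlockFace]

lemma blockFace_pair (u v : Fin 2 ×ₗ Fin m) :
    BlockFace {u, v} ↔ ((ofLex u).1 ≠ (ofLex v).1 → (ofLex u).2 = (ofLex v).2) := by
  simp only [BlockFace, mem_insert, mem_singleton, forall_eq_or_imp, forall_eq, ne_eq,
    not_true_eq_false, false_imp_iff, true_and, and_true]
  exact ⟨fun h => h.1, fun h => ⟨h, fun h' => (h (Ne.symm h')).symm⟩⟩

/-- A face with at least three vertices lies in one of the two simplices. -/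
lemma BlockFace.fst_eq {σ : Finset (Fin 2 ×ₗ Fin m)} (hσ : BlockFace σ) (h : 3 ≤ σ.card)
    {u v : Fin 2 ×ₗ Fin m} (hu : u ∈ σ) (hv : v ∈ σ) : (ofLex u).1 = (ofLex v).1 := by
  by_contra hne
  obtain ⟨w, hw, hwuv⟩ : ∃ w ∈ σ, w ∉ ({u, v} : Finset (Fin 2 ×ₗ Fin m)) := by
    by_contra hcon
    push Not at hcon
    have := (card_le_card hcon).trans card_le_two
    omega
  simp only [mem_insert, mem_singleton, not_or] at hwuv
  have huv := hσ u hu v hv hne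
  have h2 : (ofLex w).1 = (ofLex u).1 ∨ (ofLex w).1 = (ofLex v).1 := by omega
  rcases h2 with h2 | h2
  · have h3 := hσ w hw v hv (by rw [h2]; exact hne)
    exact hwuv.1 (ofLex.injective (Prod.ext h2 (h3.trans huv.symm)))
  · have h3 := hσ w hw u hu (by rw [h2]; exact Ne.symm hne)
    exact hwuv.2 (ofLex.injective (Prod.ext h2 (h3.trans huv)))

lemma blockFace_of_fst_eq {σ : Finset (Fin 2 ×ₗ Fin m)} {s : Fin 2}
    (h : ∀ u ∈ σ, (ofLex u).1 = s) : BlockFace σ :=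
  fun u hu v hv hne => absurd ((h u hu).trans (h v hv).symm) hne

lemma card_filter_fst (s : Fin 2) :
    (univ.filter fun u : Fin 2 ×ₗ Fin m => (ofLex u).1 = s).card = m := by
  have : (univ.filter fun u : Fin 2 ×ₗ Fin m => (ofLex u).1 = s) =
      univ.image fun i : Fin m => toLex (s, i) := by
    ext u
    simp only [mem_filter, mem_univ, true_and, mem_image]
    constructor
    · rintro rfl; exact ⟨(ofLex u).2, rfl⟩
    · rintro ⟨i, rfl⟩; rfl
  rw [this, card_image_of_injective, card_univ, Fintype.card_fin]
  intro i j h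
  simpa using h

/-- The Laplacian of the block on faces with at least three vertices is multiplication by `m`. -/
lemma blockLaplacian_of_three_le (f : Finset (Fin 2 ×ₗ Fin m) → ℝ) {σ : Finset (Fin 2 ×ₗ Fin m)}
    (hσ : BlockFace σ) (h : 3 ≤ σ.card) : (augLaplacian BlockFace *ᵥ f) σ = m * f σ := by
  classical
  rw [augLaplacian_mulVec BlockFace.mono f hσ]
  obtain ⟨w, hw⟩ : σ.Nonempty := card_pos.1 (by omega)
  set s := (ofLex w).1 with hs
  have hside : ∀ u ∈ σ, (ofLex u).1 = s := fun u hu => hσ.fst_eq h hu hw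
  have hins : ∀ u ∉ σ, ∀ τ ⊆ σ, 2 ≤ τ.card → BlockFace (insert u τ) → (ofLex u).1 = s := by
    intro u hu τ hτ hc hP
    obtain ⟨v, hv⟩ : τ.Nonempty := card_pos.1 (by omega)
    rw [hP.fst_eq (by rw [card_insert_of_notMem fun h => hu (hτ h)]; omega)
      (mem_insert_self u τ) (mem_insert_of_mem hv), hside v (hτ hv)]
  have hface : ∀ u, (ofLex u).1 = s → BlockFace (insert u σ) := by
    intro u hu
    refine blockFace_of_fst_eq (s := s) fun v hv => ?_
    rcases mem_insert.1 hv with rfl | hv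
    · exact hu
    · exact hside v hv
  have hcount : σ.card + (σᶜ.filter fun u => BlockFace (insert u σ)).card = m := by
    rw [← card_union_of_disjoint]
    · refine Eq.trans ?_ (card_filter_fst (m := m) s)
      congr 1
      ext u
      simp only [mem_union, mem_filter, mem_compl, mem_univ, true_and]
      constructor
      · rintro (hu | ⟨hu, hP⟩)
        · exact hside u hu
        · exact hins u hu σ subset_rfl (by omega) hP
      · intro hu
        by_cases hm : u ∈ σ
        · exact Or.inl hm
        · exact Or.inr ⟨hm, hface u hu⟩
    · exact disjoint_left.2 fun u hu hu' => (mem_compl.1 (mem_filter.1 hu').1) hu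
  rw [← Nat.cast_add, hcount, add_eq_left]
  refine sum_eq_zero fun v hv => sum_eq_zero fun u hu => if_neg ?_
  rintro ⟨h1, h2⟩
  exact h2 (hface u (hins u (mem_compl.1 hu) _ (erase_subset v σ)
    (by rw [card_erase_of_mem hv]; omega) h1))

lemma blockLaplacian_empty (f : Finset (Fin 2 ×ₗ Fin m) → ℝ) :
    (augLaplacian BlockFace *ᵥ f) ∅ = 2 * m * f ∅ := by
  classical
  rw [augLaplacian_mulVec BlockFace.mono f blockFace_empty]
  have : (filter (fun u : Fin 2 ×ₗ Fin m => BlockFace (insert u ∅)) (∅ : Finset _)ᶜ) = univ := by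
    ext u
    simpa using blockFace_singleton u
  rw [this]
  simp [card_univ]

lemma blockLaplacian_singleton (f : Finset (Fin 2 ×ₗ Fin m) → ℝ) (s : Fin 2) (i : Fin m) :
    (augLaplacian BlockFace *ᵥ f) {toLex (s, i)} =
      m * f {toLex (s, i)} + ∑ l, f {toLex (1 - s, l)} + f {toLex (s, i)} -
        f {toLex (1 - s, i)} := by
  classical
  rw [augLaplacian_mulVec BlockFace.mono f (blockFace_singleton _)]
  have hne : 1 - s ≠ s := by fin_cases s <;> decide
  have hs : ∀ t : Fin 2, t ≠ s → t = 1 - s := by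
    intro t ht; fin_cases s <;> fin_cases t <;> simp at ht ⊢
  have hcount : (filter (fun u : Fin 2 ×ₗ Fin m => BlockFace (insert u {toLex (s, i)}))
      {toLex (s, i)}ᶜ).card = m := by
    have : filter (fun u : Fin 2 ×ₗ Fin m => BlockFace (insert u {toLex (s, i)}))
        {toLex (s, i)}ᶜ =
        insert (toLex (1 - s, i))
          ((univ.filter fun u : Fin 2 ×ₗ Fin m => (ofLex u).1 = s).erase (toLex (s, i))) := by
      ext u
      induction u using Lex.rec with | _ u
      obtain ⟨t, l⟩ := u
      simp only [mem_filter, mem_compl, mem_singleton, blockFace_pair, mem_insert, mem_erase,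
        mem_univ, true_and, ofLex_toLex, toLex_inj, Prod.mk.injEq, ne_eq]
      by_cases ht : t = s
      · subst ht
        simp [hne.symm]
      · simp [ht, ← hs t ht]
    rw [this, card_insert_of_notMem, card_erase_of_mem, card_filter_fst]
    · have := i.pos
      omega
    · simp
    · simp [hne]
  rw [hcount, sum_singleton]
  have hsum : (∑ u ∈ ({toLex (s, i)} : Finset (Fin 2 ×ₗ Fin m))ᶜ,
      if BlockFace (insert u (({toLex (s, i)} : Finset (Fin 2 ×ₗ Fin m)).erase (toLex (s, i)))) ∧
        ¬ BlockFace (insert u {toLex (s, i)}) then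
      vertexSign {toLex (s, i)} (toLex (s, i)) *
        vertexSign (({toLex (s, i)} : Finset (Fin 2 ×ₗ Fin m)).erase (toLex (s, i))) u *
        f (insert u (({toLex (s, i)} : Finset (Fin 2 ×ₗ Fin m)).erase (toLex (s, i)))) else 0) =
      ∑ l ∈ univ.erase i, f {toLex (1 - s, l)} := by
    symm
    refine sum_of_injOn (fun l => toLex (1 - s, l)) ?_ ?_ ?_ ?_
    · intro l _ l' _ h
      simpa using h
    · intro l _
      simp [hne]
    · intro u hu hu'
      induction u using Lex.rec with | _ u
      obtain ⟨t, l⟩ := u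
      rw [if_neg]
      rintro ⟨-, h2⟩
      rw [blockFace_pair] at h2
      simp only [ofLex_toLex, Classical.not_imp] at h2
      exact hu' ⟨l, by simpa using h2.2, by simp [hs t h2.1]⟩
    · intro l hl
      have h2 : ¬ BlockFace {toLex (1 - s, l), toLex (s, i)} := by
        rw [blockFace_pair]
        simp only [ofLex_toLex, Classical.not_imp]
        exact ⟨hne, by simpa using hl⟩
      rw [erase_singleton, if_pos ⟨blockFace_singleton _, h2⟩]
      simp [vertexSign, filter_singleton]
  rw [hsum, ← add_sum_erase univ (fun l => f {toLex (1 - s, l)}) (mem_univ i), card_singleton]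
  push_cast
  ring

/-- On a pair of functions `x`, `y` on the two sides, the Laplacian of the block in degree zero is
`m x + ∑ y + x - y` on the first side, and symmetrically on the second. The eigenvectors are found
from `x + y` and `x - y`, split into constants and functions with sum zero. -/
lemma blockEigenvalue_of_card_one {f : Finset (Fin 2 ×ₗ Fin m) → ℝ} {c : ℝ}
    (hf : augLaplacian BlockFace *ᵥ f = c • f) {σ : Finset (Fin 2 ×ₗ Fin m)} (h : σ.card = 1)
    (hσ : f σ ≠ 0) : c = 2 ∨ c = m ∨ c = m + 2 ∨ c = 2 * m := by
  set x : Fin m → ℝ := fun i => f {toLex (0, i)} with hx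
  set y : Fin m → ℝ := fun i => f {toLex (1, i)} with hy
  have hx' : ∀ i, m * x i + ∑ l, y l + x i - y i = c * x i := by
    intro i
    have := congrFun hf {toLex (0, i)}
    rwa [blockLaplacian_singleton] at this
  have hy' : ∀ i, m * y i + ∑ l, x l + y i - x i = c * y i := by
    intro i
    have := congrFun hf {toLex (1, i)}
    rwa [blockLaplacian_singleton] at this
  have hxs := sum_congr (rfl : (univ : Finset (Fin m)) = univ) fun i _ => hx' i
  have hys := sum_congr (rfl : (univ : Finset (Fin m)) = univ) fun i _ => hy' i
  simp only [sum_sub_distrib, sum_add_distrib, ← mul_sum, sum_const, card_univ, Fintype.card_fin,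
    nsmul_eq_mul] at hxs hys
  set X := ∑ l, x l
  set Y := ∑ l, y l
  by_cases hp : X + Y = 0
  · by_cases hm : X - Y = 0
    · have hX : X = 0 := by linarith
      have hY : Y = 0 := by linarith
      obtain ⟨u, rfl⟩ := card_eq_one.1 h
      induction u using Lex.rec with | _ u
      obtain ⟨t, i⟩ := u
      have h1 := hx' i
      have h2 := hy' i
      rw [hY] at h1
      rw [hX] at h2
      by_cases hs : x i + y i = 0
      · by_cases hd : x i - y i = 0
        · have hxi : x i = 0 := by linarith
          have hyi : y i = 0 := by linarith
          exfalso
          apply hσ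
          fin_cases t
          · exact hxi
          · exact hyi
        · refine Or.inr (Or.inr (Or.inl (mul_right_cancel₀ hd ?_)))
          linarith
      · refine Or.inr (Or.inl (mul_right_cancel₀ hs ?_))
        linarith
    · refine Or.inl (mul_right_cancel₀ hm ?_)
      linarith
  · refine Or.inr (Or.inr (Or.inr (mul_right_cancel₀ hp ?_)))
    linarith

/-- The eigenvalues of the block in degree `|σ| - 1`. In degree one, for a nonzero eigenvalue,
either the boundary or the coboundary of the eigenvector is an eigenvector in degree zero or two.
For faces with two or more vertices the list is not sharp: it gives what the bounds need. -/
lemma blockEigenvalue {f : Finset (Fin 2 ×ₗ Fin m) → ℝ} {c : ℝ}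
    (hf : augLaplacian BlockFace *ᵥ f = c • f) {σ : Finset (Fin 2 ×ₗ Fin m)} (hP : BlockFace σ)
    (hσ : f σ ≠ 0) :
    (σ.card = 0 ∧ c = 2 * m) ∨ (σ.card = 1 ∧ (c = 2 ∨ c = m ∨ c = m + 2 ∨ c = 2 * m)) ∨
      (2 ≤ σ.card ∧ (c = 0 ∨ c = 2 ∨ c = m ∨ c = m + 2 ∨ c = 2 * m)) := by
  classical
  have hthree : ∀ {g : Finset (Fin 2 ×ₗ Fin m) → ℝ}, augLaplacian BlockFace *ᵥ g = c • g →
      ∀ {τ}, BlockFace τ → g τ ≠ 0 → 3 ≤ τ.card → c = m := by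
    intro g hg τ hPτ hτ h3
    have h1 := congrFun hg τ
    rw [blockLaplacian_of_three_le g hPτ h3] at h1
    exact mul_right_cancel₀ hτ h1.symm
  rcases Nat.lt_or_ge σ.card 3 with h | h
  · interval_cases hc : σ.card
    · left
      rw [card_eq_zero.1 hc] at hσ
      have h1 := congrFun hf ∅
      rw [blockLaplacian_empty] at h1
      exact ⟨rfl, mul_right_cancel₀ hσ h1.symm⟩
    · exact Or.inr (Or.inl ⟨rfl, blockEigenvalue_of_card_one hf hc hσ⟩)
    · refine Or.inr (Or.inr ⟨le_rfl, ?_⟩)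
      by_cases h0 : c = 0
      · exact Or.inl h0
      have h1 := congrFun hf σ
      rw [augLaplacian, add_mulVec, Pi.add_apply, ← mulVec_mulVec, ← mulVec_mulVec,
        augBoundary_mulVec, augBoundary_transpose_mulVec, if_pos hP] at h1
      have hne : c * f σ ≠ 0 := mul_ne_zero h0 hσ
      have hcomm : ∀ M : Matrix (Finset (Fin 2 ×ₗ Fin m)) (Finset (Fin 2 ×ₗ Fin m)) ℝ,
          augLaplacian BlockFace * M = M * augLaplacian BlockFace →
          augLaplacian BlockFace *ᵥ (M *ᵥ f) = c • (M *ᵥ f) := by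
        intro M hM
        rw [mulVec_mulVec, hM, ← mulVec_mulVec, hf, mulVec_smul]
      by_cases hdown : ∀ v ∈ σ, (augBoundary BlockFace *ᵥ f) (σ.erase v) = 0
      · rw [sum_eq_zero (s := σ) fun v hv => by rw [hdown v hv, mul_zero], add_zero] at h1
        have hne' : c • f σ ≠ 0 := hne
        rw [Pi.smul_apply] at h1
        rw [← h1] at hne'
        obtain ⟨u, hu, hne''⟩ := exists_ne_zero_of_sum_ne_zero hne'
        have hface : BlockFace (insert u σ) := by
          by_contra hcon
          exact hne'' (if_neg hcon)
        rw [if_pos hface] at hne''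
        refine Or.inr (Or.inr (Or.inl (hthree
          (hcomm _ (augLaplacian_mul_augBoundary_transpose BlockFace.mono)) hface
          (right_ne_zero_of_mul hne'') ?_)))
        rw [card_insert_of_notMem (mem_compl.1 hu), hc]
      · push Not at hdown
        obtain ⟨v, hv, hne'⟩ := hdown
        exact Or.inr (blockEigenvalue_of_card_one
          (hcomm _ (augLaplacian_mul_augBoundary BlockFace.mono))
          (by rw [card_erase_of_mem hv, hc]) hne')
  · exact Or.inr (Or.inr ⟨by omega, Or.inr (Or.inr (Or.inl (hthree hf hP hσ h)))⟩)

end Block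

/-! ### Eigenvectors of the block -/

section BlockEigenvectors

variable {m : ℕ}

open scoped Classical in
/-- The chain `∑ i, g i ((0, i) - (1, i))` of degree zero. -/
def vertexDifference (g : Fin m → ℝ) (σ : Finset (Fin 2 ×ₗ Fin m)) : ℝ :=
  ∑ i, ((if σ = {toLex (0, i)} then g i else 0) - if σ = {toLex (1, i)} then g i else 0)

open scoped Classical in
/-- The chain `∑ i, g i [(0, i), (1, i)]` of degree one, on the edges of the matching. -/
def matchingChain (g : Fin m → ℝ) (σ : Finset (Fin 2 ×ₗ Fin m)) : ℝ :=
  ∑ i, if σ = {toLex (0, i), toLex (1, i)} then g i else 0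

lemma vertexDifference_zero (g : Fin m → ℝ) (i : Fin m) :
    vertexDifference g {toLex (0, i)} = g i := by
  simp [vertexDifference]

lemma vertexDifference_one (g : Fin m → ℝ) (i : Fin m) :
    vertexDifference g {toLex (1, i)} = -g i := by
  simp [vertexDifference]

lemma card_of_vertexDifference_ne_zero {g : Fin m → ℝ} {σ : Finset (Fin 2 ×ₗ Fin m)}
    (h : vertexDifference g σ ≠ 0) : σ.card = 1 := by
  obtain ⟨i, -, hi⟩ := exists_ne_zero_of_sum_ne_zero h
  by_contra hc
  apply hi
  rw [if_neg, if_neg, sub_zero]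
  · rintro rfl; simp at hc
  · rintro rfl; simp at hc

lemma matching_injective {i j : Fin m} (h : ({toLex (0, i), toLex (1, i)} :
    Finset (Fin 2 ×ₗ Fin m)) = {toLex (0, j), toLex (1, j)}) : i = j := by
  have : (toLex (0, i) : Fin 2 ×ₗ Fin m) ∈ ({toLex (0, j), toLex (1, j)} : Finset _) := by
    rw [← h]; simp
  simpa using this

lemma matchingChain_apply (g : Fin m → ℝ) (i : Fin m) :
    matchingChain g {toLex (0, i), toLex (1, i)} = g i := by
  unfold matchingChain
  rw [sum_eq_single i]
  · simp
  · intro j _ hj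
    exact if_neg fun h => hj (matching_injective h).symm
  · simp

lemma exists_of_matchingChain_ne_zero {g : Fin m → ℝ} {σ : Finset (Fin 2 ×ₗ Fin m)}
    (h : matchingChain g σ ≠ 0) : ∃ i, σ = {toLex (0, i), toLex (1, i)} := by
  obtain ⟨i, -, hi⟩ := exists_ne_zero_of_sum_ne_zero h
  exact ⟨i, by by_contra hc; exact hi (if_neg hc)⟩

lemma card_of_matchingChain_ne_zero {g : Fin m → ℝ} {σ : Finset (Fin 2 ×ₗ Fin m)}
    (h : matchingChain g σ ≠ 0) : σ.card = 2 := by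
  obtain ⟨i, rfl⟩ := exists_of_matchingChain_ne_zero h
  exact card_pair (by simp)

lemma blockFace_matching (i : Fin m) :
    BlockFace ({toLex (0, i), toLex (1, i)} : Finset (Fin 2 ×ₗ Fin m)) := by
  simp [blockFace_pair]

lemma augLaplacian_mulVec_vertexDifference (g : Fin m → ℝ) :
    augLaplacian BlockFace *ᵥ vertexDifference g =
      vertexDifference fun i => (m + 2) * g i - ∑ l, g l := by
  classical
  ext σ
  by_cases hc : σ.card = 1
  · obtain ⟨u, rfl⟩ := card_eq_one.1 hc
    induction u using Lex.rec with | _ u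
    obtain ⟨t, i⟩ := u
    rw [blockLaplacian_singleton]
    fin_cases t
    · simp only [Fin.zero_eta, sub_zero, vertexDifference_zero, vertexDifference_one,
        sum_neg_distrib]
      ring
    · simp only [Fin.mk_one, sub_self, vertexDifference_zero, vertexDifference_one]
      ring
  · have hz : ∀ (g : Fin m → ℝ) {τ : Finset (Fin 2 ×ₗ Fin m)}, τ.card ≠ 1 →
        vertexDifference g τ = 0 := fun g τ hτ => by
      by_contra h
      exact hτ (card_of_vertexDifference_ne_zero h)
    rw [hz _ hc]
    by_cases hP : BlockFace σ
    · rw [augLaplacian_mulVec BlockFace.mono _ hP, hz _ hc, mul_zero, zero_add]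
      refine sum_eq_zero fun v hv => sum_eq_zero fun u hu => ?_
      rw [hz, mul_zero, ite_self]
      rwa [card_insert_of_notMem fun h => (mem_compl.1 hu) (mem_of_mem_erase h),
        card_erase_add_one hv]
    · exact augLaplacian_mulVec_of_not BlockFace.mono _ hP

lemma augBoundary_mulVec_matchingChain (g : Fin m → ℝ) :
    augBoundary BlockFace *ᵥ matchingChain g = -vertexDifference g := by
  classical
  ext σ
  rw [augBoundary_mulVec, Pi.neg_apply]
  by_cases hc : σ.card = 1
  · obtain ⟨u, rfl⟩ := card_eq_one.1 hc
    induction u using Lex.rec with | _ u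
    obtain ⟨t, i⟩ := u
    have hne : 1 - t ≠ t := by fin_cases t <;> decide
    have hpair : ({toLex (1 - t, i), toLex (t, i)} : Finset (Fin 2 ×ₗ Fin m)) =
        {toLex (0, i), toLex (1, i)} := by
      fin_cases t
      · exact pair_comm _ _
      · rfl
    rw [sum_eq_single (toLex (1 - t, i)), hpair, if_pos (blockFace_matching i),
      matchingChain_apply]
    · fin_cases t
      · simp [vertexSign, filter_singleton, vertexDifference_zero, Prod.Lex.toLex_lt_toLex]
      · simp [vertexSign, filter_singleton, vertexDifference_one, Prod.Lex.toLex_lt_toLex]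
    · intro v hv hvne
      by_contra h
      have h1 : matchingChain g (insert v {toLex (t, i)}) ≠ 0 := by
        intro h0; simp [h0] at h
      obtain ⟨j, hj⟩ := exists_of_matchingChain_ne_zero h1
      have hij : j = i := by
        have : (toLex (t, i) : Fin 2 ×ₗ Fin m) ∈ ({toLex (0, j), toLex (1, j)} : Finset _) := by
          rw [← hj]; simp
        simp only [mem_insert, mem_singleton, toLex_inj, Prod.mk.injEq] at this
        rcases this with h | h <;> exact h.2.symm
      subst hij
      have : v ∈ ({toLex (1 - t, j), toLex (t, j)} : Finset _) := by
        rw [hpair, ← hj]; simp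
      simp only [mem_insert, mem_singleton] at this
      rcases this with h | h
      · exact hvne h
      · simp [h] at hv
    · intro h
      exact absurd h (by simp [hne])
  · have hz : vertexDifference g σ = 0 := by
      by_contra h
      exact hc (card_of_vertexDifference_ne_zero h)
    rw [hz, neg_zero]
    refine sum_eq_zero fun v hv => ?_
    have : matchingChain g (insert v σ) = 0 := by
      by_contra h
      have := card_of_matchingChain_ne_zero h
      rw [card_insert_of_notMem (mem_compl.1 hv)] at this
      omega
    rw [this, mul_zero, ite_self]

/-- The edges of the matching are maximal faces. -/
lemma augBoundary_transpose_mulVec_matchingChain (g : Fin m → ℝ) :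
    (augBoundary BlockFace)ᵀ *ᵥ matchingChain g = 0 := by
  classical
  ext σ
  rw [augBoundary_transpose_mulVec, Pi.zero_apply]
  split_ifs with hP
  · refine sum_eq_zero fun v hv => ?_
    by_contra h
    obtain ⟨i, hi⟩ := exists_of_matchingChain_ne_zero (right_ne_zero_of_mul h)
    have hc : (σ.erase v).card = 2 := card_of_matchingChain_ne_zero (right_ne_zero_of_mul h)
    rw [card_erase_of_mem hv] at hc
    have h0 : (toLex (0, i) : Fin 2 ×ₗ Fin m) ∈ σ.erase v := by rw [hi]; simp
    have h1 : (toLex (1, i) : Fin 2 ×ₗ Fin m) ∈ σ.erase v := by rw [hi]; simp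
    have := hP.fst_eq (by omega) (mem_of_mem_erase h0) (mem_of_mem_erase h1)
    simp at this
  · rfl

lemma augBoundary_transpose_mulVec_vertexDifference (g : Fin m → ℝ) (i : Fin m) :
    ((augBoundary BlockFace)ᵀ *ᵥ vertexDifference g) {toLex (0, i), toLex (1, i)} =
      -(2 * g i) := by
  classical
  have hne : (toLex (0, i) : Fin 2 ×ₗ Fin m) ≠ toLex (1, i) := by simp
  have h1 : ({toLex (0, i), toLex (1, i)} : Finset (Fin 2 ×ₗ Fin m)).erase (toLex (1, i)) =
      {toLex (0, i)} := by
    rw [pair_comm, erase_insert]; simp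
  rw [augBoundary_transpose_mulVec, if_pos (blockFace_matching i), sum_pair hne, h1,
    erase_insert (by simp), vertexDifference_zero, vertexDifference_one]
  simp [vertexSign, filter_insert, filter_singleton, Prod.Lex.toLex_lt_toLex]
  ring

lemma of_augBoundary_transpose_vertexDifference_ne_zero {g : Fin m → ℝ}
    {σ : Finset (Fin 2 ×ₗ Fin m)}
    (h : ((augBoundary BlockFace)ᵀ *ᵥ vertexDifference g) σ ≠ 0) :
    BlockFace σ ∧ σ.card = 2 := by
  classical
  rw [augBoundary_transpose_mulVec] at h
  have hP : BlockFace σ := by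
    by_contra hc
    exact h (if_neg hc)
  rw [if_pos hP] at h
  obtain ⟨v, hv, hne⟩ := exists_ne_zero_of_sum_ne_zero h
  have hc := card_of_vertexDifference_ne_zero (right_ne_zero_of_mul hne)
  rw [← card_erase_add_one hv, hc]
  exact ⟨hP, rfl⟩

lemma augLaplacian_mulVec_vertexDifference_one :
    augLaplacian BlockFace *ᵥ vertexDifference (fun _ : Fin m => 1) =
      (2 : ℝ) • vertexDifference (fun _ : Fin m => 1) := by
  rw [augLaplacian_mulVec_vertexDifference]
  ext σ
  simp only [vertexDifference, Pi.smul_apply, smul_eq_mul, mul_sum]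
  refine sum_congr rfl fun i _ => ?_
  simp
  split_ifs <;> ring

lemma exists_blockEigenvector_vertices (hm : 1 ≤ m) :
    ∃ f : Finset (Fin 2 ×ₗ Fin m) → ℝ, f ≠ 0 ∧ augLaplacian BlockFace *ᵥ f = (2 : ℝ) • f ∧
      ∀ σ, f σ ≠ 0 → BlockFace σ ∧ σ.card = 1 := by
  refine ⟨vertexDifference fun _ => 1, fun h => ?_, augLaplacian_mulVec_vertexDifference_one,
    fun σ h => ?_⟩
  · have := congrFun h {toLex (0, ⟨0, hm⟩)}
    rw [vertexDifference_zero] at this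
    exact one_ne_zero this
  · have hc := card_of_vertexDifference_ne_zero h
    obtain ⟨u, rfl⟩ := card_eq_one.1 hc
    exact ⟨blockFace_singleton u, hc⟩

lemma exists_blockEigenvector_edges (hm : 1 ≤ m) :
    ∃ f : Finset (Fin 2 ×ₗ Fin m) → ℝ, f ≠ 0 ∧ augLaplacian BlockFace *ᵥ f = (2 : ℝ) • f ∧
      ∀ σ, f σ ≠ 0 → BlockFace σ ∧ σ.card = 2 := by
  refine ⟨(augBoundary BlockFace)ᵀ *ᵥ vertexDifference fun _ => 1, fun h => ?_, ?_,
    fun σ h => of_augBoundary_transpose_vertexDifference_ne_zero h⟩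
  · have := congrFun h {toLex (0, ⟨0, hm⟩), toLex (1, ⟨0, hm⟩)}
    rw [augBoundary_transpose_mulVec_vertexDifference] at this
    simp at this
  · rw [mulVec_mulVec, augLaplacian_mul_augBoundary_transpose BlockFace.mono, ← mulVec_mulVec,
      augLaplacian_mulVec_vertexDifference_one, mulVec_smul]

/-- For two matched pairs of vertices there is a nonzero harmonic chain in degree one: the
projection of a difference of two edges of the matching to the cycles. -/
lemma exists_blockEigenvector_harmonic (hm : 2 ≤ m) :
    ∃ f : Finset (Fin 2 ×ₗ Fin m) → ℝ, f ≠ 0 ∧ augLaplacian BlockFace *ᵥ f = (0 : ℝ) • f ∧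
      ∀ σ, f σ ≠ 0 → BlockFace σ ∧ σ.card = 2 := by
  classical
  set i₀ : Fin m := ⟨0, by omega⟩
  set i₁ : Fin m := ⟨1, by omega⟩
  have h01 : i₀ ≠ i₁ := by simp [i₀, i₁]
  set g : Fin m → ℝ := Pi.single i₀ 1 - Pi.single i₁ 1 with hg
  have hsum : ∑ i, g i = 0 := by simp [hg, sum_sub_distrib]
  have hg0 : g i₀ = 1 := by simp [hg, h01]
  have hm0 : (m : ℝ) + 2 ≠ 0 := by positivity
  have hv : augLaplacian BlockFace *ᵥ vertexDifference g =
      ((m : ℝ) + 2) • vertexDifference g := by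
    rw [augLaplacian_mulVec_vertexDifference, hsum]
    ext σ
    simp only [vertexDifference, Pi.smul_apply, smul_eq_mul, mul_sum]
    refine sum_congr rfl fun i _ => ?_
    split_ifs <;> ring
  refine ⟨matchingChain g + ((m : ℝ) + 2)⁻¹ • (augBoundary BlockFace)ᵀ *ᵥ vertexDifference g,
    fun h => ?_, ?_, fun σ h => ?_⟩
  · have := congrFun h {toLex (0, i₀), toLex (1, i₀)}
    simp only [Pi.add_apply, Pi.smul_apply, matchingChain_apply,
      augBoundary_transpose_mulVec_vertexDifference, hg0, smul_eq_mul, Pi.zero_apply] at this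
    field_simp at this
    have hmpos : (0 : ℝ) < m := by exact_mod_cast (by omega : 0 < m)
    linarith
  · have h1 : augLaplacian BlockFace *ᵥ matchingChain g =
        -((augBoundary BlockFace)ᵀ *ᵥ vertexDifference g) := by
      rw [augLaplacian, add_mulVec, ← mulVec_mulVec, ← mulVec_mulVec,
        augBoundary_transpose_mulVec_matchingChain, augBoundary_mulVec_matchingChain,
        mulVec_zero, zero_add, mulVec_neg]
    rw [mulVec_add, h1, mulVec_smul, mulVec_mulVec,
      augLaplacian_mul_augBoundary_transpose BlockFace.mono, ← mulVec_mulVec, hv, mulVec_smul,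
      smul_smul, inv_mul_cancel₀ hm0, one_smul, zero_smul, neg_add_cancel]
  · by_cases h1 : matchingChain g σ = 0
    · rw [Pi.add_apply, h1, zero_add, Pi.smul_apply, smul_eq_mul] at h
      exact of_augBoundary_transpose_vertexDifference_ne_zero (right_ne_zero_of_mul h)
    · have hc := card_of_matchingChain_ne_zero h1
      obtain ⟨i, rfl⟩ := exists_of_matchingChain_ne_zero h1
      exact ⟨blockFace_matching i, hc⟩

end BlockEigenvectors

/-! ### Operators on tensor powers -/

section Factors

variable {ι F : Type*} [LinearOrder ι]

section

variable [Fintype F]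

/-- The operator `1 ⊗ ⋯ ⊗ M ⊗ ⋯ ⊗ 1` with `M` in the factor `j`, on the tensor power of the space
of functions on `F`, written as the space of functions on `ι → F`. -/
def factorOp (j : ι) (M : Matrix F F ℝ) (X : (ι → F) → ℝ) (φ : ι → F) : ℝ :=
  ∑ τ, M (φ j) τ * X (Function.update φ j τ)

lemma factorOp_add (j : ι) (M N : Matrix F F ℝ) (X : (ι → F) → ℝ) :
    factorOp j (M + N) X = factorOp j M X + factorOp j N X := by
  ext φ; simp [factorOp, add_mul, sum_add_distrib]

lemma factorOp_mul (j : ι) (M N : Matrix F F ℝ) (X : (ι → F) → ℝ) :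
    factorOp j (M * N) X = factorOp j M (factorOp j N X) := by
  ext φ
  simp only [factorOp, Matrix.mul_apply, Function.update_self, Function.update_idem, sum_mul,
    mul_sum]
  rw [sum_comm]
  exact sum_congr rfl fun _ _ => sum_congr rfl fun _ _ => by ring

end

variable [Fintype ι]

/-- The sign `ε ⊗ ⋯ ⊗ ε ⊗ 1 ⊗ ⋯ ⊗ 1`, with `ε` in the factors before `j`. -/
def prefixSign (ε : F → ℝ) (j : ι) (φ : ι → F) : ℝ :=
  ∏ i with i < j, ε (φ i)

lemma prefixSign_mul_self {ε : F → ℝ} (hε : ∀ σ, ε σ * ε σ = 1) (j : ι) (φ : ι → F) :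
    prefixSign ε j φ * prefixSign ε j φ = 1 := by
  rw [prefixSign, ← prod_mul_distrib]
  exact prod_eq_one fun i _ => hε _

lemma prefixSign_update_of_le (ε : F → ℝ) {i j : ι} (hij : i ≤ j) (φ : ι → F) (τ : F) :
    prefixSign ε i (Function.update φ j τ) = prefixSign ε i φ := by
  refine prod_congr rfl fun l hl => ?_
  rw [Function.update_of_ne]
  exact ((mem_filter.1 hl).2.trans_le hij).ne

lemma prefixSign_update_of_lt {ε : F → ℝ} (hε : ∀ σ, ε σ * ε σ = 1) {i j : ι} (hij : i < j)
    (φ : ι → F) (τ : F) :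
    prefixSign ε j (Function.update φ i τ) = ε (φ i) * ε τ * prefixSign ε j φ := by
  have hi : i ∈ (univ.filter (· < j) : Finset ι) := by simp [hij]
  rw [prefixSign, prefixSign, ← mul_prod_erase _ _ hi, ← mul_prod_erase _ _ hi,
    Function.update_self]
  have : ∏ l ∈ (univ.filter (· < j)).erase i, ε (Function.update φ i τ l) =
      ∏ l ∈ (univ.filter (· < j)).erase i, ε (φ l) :=
    prod_congr rfl fun l hl => by rw [Function.update_of_ne (ne_of_mem_erase hl)]
  rw [this]
  linear_combination (-ε τ * ∏ l ∈ (univ.filter (· < j)).erase i, ε (φ l)) * hε (φ i)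

variable [Fintype F]

/-- The operator `ε ⊗ ⋯ ⊗ ε ⊗ M ⊗ 1 ⊗ ⋯ ⊗ 1` with `M` in the factor `j`. -/
def signedFactorOp (ε : F → ℝ) (j : ι) (M : Matrix F F ℝ) (X : (ι → F) → ℝ) (φ : ι → F) : ℝ :=
  prefixSign ε j φ * factorOp j M X φ

/-- Operators that anticommute with `ε`, put into different factors, anticommute. -/
lemma signedFactorOp_anticomm {ε : F → ℝ} (hε : ∀ σ, ε σ * ε σ = 1) {M N : Matrix F F ℝ}
    (hM : ∀ σ τ, ε σ * ε τ * M σ τ = -M σ τ) {i j : ι} (hij : i < j) (X : (ι → F) → ℝ) :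
    signedFactorOp ε i M (signedFactorOp ε j N X) +
      signedFactorOp ε j N (signedFactorOp ε i M X) = 0 := by
  ext φ
  simp only [signedFactorOp, factorOp, Pi.add_apply, Pi.zero_apply,
    prefixSign_update_of_le ε hij.le, prefixSign_update_of_lt hε hij,
    Function.update_of_ne hij.ne, Function.update_of_ne hij.ne', mul_sum]
  rw [sum_comm (s := univ) (t := univ) (f := fun τ υ => prefixSign ε j φ * (N (φ j) τ *
    (prefixSign ε i φ * (M (φ i) υ * X (Function.update (Function.update φ j τ) i υ))))),
    ← sum_add_distrib]
  refine sum_eq_zero fun τ _ => ?_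
  rw [← sum_add_distrib]
  refine sum_eq_zero fun υ _ => ?_
  rw [Function.update_comm hij.ne]
  linear_combination (prefixSign ε i φ * prefixSign ε j φ * N (φ j) υ *
    X (Function.update (Function.update φ j υ) i τ)) * hM (φ i) τ

lemma signedFactorOp_same {ε : F → ℝ} (hε : ∀ σ, ε σ * ε σ = 1) (M N : Matrix F F ℝ) (i : ι)
    (X : (ι → F) → ℝ) :
    signedFactorOp ε i M (signedFactorOp ε i N X) = factorOp i (M * N) X := by
  ext φ
  rw [factorOp_mul]
  simp only [signedFactorOp, factorOp, prefixSign_update_of_le ε le_rfl, mul_sum]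
  refine sum_congr rfl fun τ _ => sum_congr rfl fun υ _ => ?_
  linear_combination (M (φ i) τ * (N (Function.update φ i τ i) υ *
    X (Function.update (Function.update φ i τ) i υ))) * prefixSign_mul_self hε i φ

lemma signedFactorOp_sum (ε : F → ℝ) (M : Matrix F F ℝ) (j : ι) (s : Finset ι)
    (X : ι → (ι → F) → ℝ) :
    signedFactorOp ε j M (∑ i ∈ s, X i) = ∑ i ∈ s, signedFactorOp ε j M (X i) := by
  ext φ
  simp only [signedFactorOp, factorOp, Finset.sum_apply, mul_sum]
  rw [sum_comm]

/-- The anticommutator of two sums of odd operators is the sum of the anticommutators in the single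
factors. For the boundary map and its transpose this says that the Laplacian of a join is the sum of
the Laplacians of the factors. -/
lemma sum_signedFactorOp_anticommutator {ε : F → ℝ} (hε : ∀ σ, ε σ * ε σ = 1)
    {M N : Matrix F F ℝ} (hM : ∀ σ τ, ε σ * ε τ * M σ τ = -M σ τ)
    (hN : ∀ σ τ, ε σ * ε τ * N σ τ = -N σ τ) (X : (ι → F) → ℝ) :
    ∑ i, signedFactorOp ε i M (∑ j, signedFactorOp ε j N X) +
      ∑ j, signedFactorOp ε j N (∑ i, signedFactorOp ε i M X) =
      ∑ i, factorOp i (M * N + N * M) X := by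
  simp only [signedFactorOp_sum]
  rw [sum_comm (s := univ) (t := univ) (f := fun j i =>
    signedFactorOp ε j N (signedFactorOp ε i M X)), ← sum_add_distrib]
  refine sum_congr rfl fun i _ => ?_
  rw [← sum_add_distrib, sum_eq_single i]
  · rw [signedFactorOp_same hε, signedFactorOp_same hε, factorOp_add]
  · intro j _ hj
    rcases lt_or_gt_of_ne hj with h | h
    · rw [add_comm]; exact signedFactorOp_anticomm hε hN h X
    · exact signedFactorOp_anticomm hε hM h X
  · simp

/-- The transpose of `factorOp j M` is `factorOp j Mᵀ`. -/
lemma sum_mul_factorOp [DecidableEq F] (j : ι) (M : Matrix F F ℝ) (X Y : (ι → F) → ℝ) :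
    ∑ φ, Y φ * factorOp j M X φ = ∑ φ, factorOp j Mᵀ Y φ * X φ := by
  simp only [factorOp, mul_sum, sum_mul, transpose_apply]
  rw [← Fintype.sum_prod_type', ← Fintype.sum_prod_type']
  refine sum_nbij' (fun p => (Function.update p.1 j p.2, p.1 j))
    (fun p => (Function.update p.1 j p.2, p.1 j)) (by simp) (by simp) (by simp) (by simp) ?_
  intro p _
  simp
  ring

lemma factorOp_prod (j : ι) (M : Matrix F F ℝ) (f : ι → F → ℝ) {c : ℝ}
    (h : M *ᵥ f j = c • f j) :
    factorOp j M (fun φ => ∏ i, f i (φ i)) = c • fun φ => ∏ i, f i (φ i) := by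
  ext φ
  have key : ∀ τ, ∏ i, f i (Function.update φ j τ i) =
      f j τ * ∏ i ∈ univ.erase j, f i (φ i) := by
    intro τ
    rw [← mul_prod_erase _ _ (mem_univ j), Function.update_self]
    congr 1
    exact prod_congr rfl fun l hl => by rw [Function.update_of_ne (ne_of_mem_erase hl)]
  have h' := congrFun h (φ j)
  simp only [mulVec, dotProduct, Pi.smul_apply, smul_eq_mul] at h'
  simp only [factorOp, key, ← mul_assoc, ← sum_mul, h', Pi.smul_apply, smul_eq_mul]
  rw [mul_assoc, mul_prod_erase univ (fun i => f i (φ i)) (mem_univ j)]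

lemma sum_factorOp_prod (M : Matrix F F ℝ) (f : ι → F → ℝ) {c : ι → ℝ}
    (h : ∀ j, M *ᵥ f j = c j • f j) :
    ∑ j, factorOp j M (fun φ => ∏ i, f i (φ i)) = (∑ j, c j) • fun φ => ∏ i, f i (φ i) := by
  rw [sum_smul]
  exact sum_congr rfl fun j _ => factorOp_prod j M f (h j)

/-- An eigenvalue of a sum `∑ j, 1 ⊗ ⋯ ⊗ A ⊗ ⋯ ⊗ 1` is a sum of eigenvalues of `A`: an eigenfunction
`X` has a nonzero coefficient at some product `f₁ ⊗ ⋯ ⊗ f_k` of eigenvectors of `A`, and then the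
supports of `X` and of the product meet. -/
lemma exists_eigenvectors_of_sum_factorOp [DecidableEq F] {A : Matrix F F ℝ} (hA : A.IsHermitian)
    {X : (ι → F) → ℝ} (hX : X ≠ 0) {μ : ℝ} (h : ∑ j, factorOp j A X = μ • X) :
    ∃ (φ : ι → F) (c : ι → ℝ) (f : ι → F → ℝ), X φ ≠ 0 ∧ (∀ j, A *ᵥ f j = c j • f j) ∧
      (∀ j, f j (φ j) ≠ 0) ∧ ∑ j, c j = μ := by
  set v : F → F → ℝ := fun s => (hA.eigenvectorBasis s).ofLp with hv
  have hAv : ∀ s, A *ᵥ v s = hA.eigenvalues s • v s := fun s => hA.mulVec_eigenvectorBasis s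
  have horth : ∀ σ τ, ∑ s, v s σ * v s τ = if σ = τ then 1 else 0 := by
    intro σ τ
    have h1 := hA.eigenvectorUnitary.2
    rw [Matrix.mem_unitaryGroup_iff] at h1
    have h2 := congrFun (congrFun h1 σ) τ
    simpa [Matrix.mul_apply, Matrix.one_apply, Matrix.star_apply] using h2
  have hT : Aᵀ = A := by
    simpa [Matrix.IsHermitian, Matrix.conjTranspose_eq_transpose_of_trivial] using hA
  by_cases hc : ∀ s : ι → F, ∑ φ, (∏ j, v (s j) (φ j)) * X φ = 0
  · exfalso
    apply hX
    ext φ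
    have h1 : ∀ ψ, (∑ s : ι → F, ∏ j, v (s j) (φ j) * v (s j) (ψ j)) =
        if φ = ψ then 1 else 0 := by
      intro ψ
      rw [← Fintype.prod_sum (fun j a => v a (φ j) * v a (ψ j))]
      simp only [horth]
      split_ifs with hφ
      · simp [hφ]
      · obtain ⟨j, hj⟩ := Function.ne_iff.1 hφ
        exact prod_eq_zero (mem_univ j) (if_neg hj)
    calc X φ = ∑ ψ, (if φ = ψ then 1 else 0) * X ψ := by simp
      _ = ∑ ψ, (∑ s : ι → F, ∏ j, v (s j) (φ j) * v (s j) (ψ j)) * X ψ := by simp only [h1]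
      _ = ∑ s : ι → F, (∏ j, v (s j) (φ j)) * ∑ ψ, (∏ j, v (s j) (ψ j)) * X ψ := by
        simp only [sum_mul, mul_sum, prod_mul_distrib]
        rw [sum_comm]
        exact sum_congr rfl fun _ _ => sum_congr rfl fun _ _ => by ring
      _ = 0 := by simp [hc]
  · push Not at hc
    obtain ⟨s, hs⟩ := hc
    obtain ⟨φ, -, hφ⟩ := exists_ne_zero_of_sum_ne_zero hs
    refine ⟨φ, fun j => hA.eigenvalues (s j), fun j => v (s j), right_ne_zero_of_mul hφ,
      fun j => hAv (s j), fun j => ?_, ?_⟩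
    · exact prod_ne_zero_iff.1 (left_ne_zero_of_mul hφ) j (mem_univ j)
    · apply mul_right_cancel₀ hs
      calc (∑ j, hA.eigenvalues (s j)) * ∑ φ, (∏ j, v (s j) (φ j)) * X φ
          = ∑ j, ∑ φ, factorOp j Aᵀ (fun φ => ∏ j, v (s j) (φ j)) φ * X φ := by
            rw [sum_mul]
            refine sum_congr rfl fun j _ => ?_
            rw [hT, factorOp_prod j A (fun j => v (s j)) (hAv (s j)), mul_sum]
            exact sum_congr rfl fun φ _ => by simp [mul_assoc]
        _ = ∑ φ, (∏ j, v (s j) (φ j)) * (∑ j, factorOp j A X) φ := by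
            simp only [← sum_mul_factorOp, Finset.sum_apply, mul_sum]
            rw [sum_comm]
        _ = μ * ∑ φ, (∏ j, v (s j) (φ j)) * X φ := by
            rw [h, mul_sum]
            exact sum_congr rfl fun φ _ => by simp; ring

end Factors

/-! ### Chains of a simplicial complex as functions on finite sets -/

section SimplexChains

variable {V : Type*} (K : AbstractSimplicialComplex V)

/-- The faces of `K` together with the empty set. -/
def AbstractSimplicialComplex.AugFace (σ : Finset V) : Prop := σ = ∅ ∨ σ ∈ K

variable {K}

lemma AbstractSimplicialComplex.AugFace.mono (σ τ : Finset V) (h : τ ⊆ σ) (hσ : K.AugFace σ) :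
    K.AugFace τ := by
  rcases hσ with rfl | hσ
  · exact Or.inl (subset_empty.1 h)
  · rcases τ.eq_empty_or_nonempty with hτ | hτ
    · exact Or.inl hτ
    · exact Or.inr ((K.isRelLowerSet_faces hσ).2 h hτ)

open scoped Classical in
/-- A `d`-chain of `K`, extended by zero to all finite sets of vertices. -/
def extendChain {d : ℕ} (x : K.Simplex d → ℝ) (σ : Finset V) : ℝ :=
  if h : σ ∈ K ∧ σ.card = d + 1 then x ⟨σ, h⟩ else 0

lemma extendChain_coe {d : ℕ} (x : K.Simplex d → ℝ) (σ : K.Simplex d) :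
    extendChain x σ.1 = x σ := by
  rw [extendChain, dif_pos σ.2]
  rfl

lemma of_extendChain_ne_zero {d : ℕ} {x : K.Simplex d → ℝ} {σ : Finset V}
    (h : extendChain x σ ≠ 0) : σ ∈ K ∧ σ.card = d + 1 := by
  by_contra hσ
  exact h (dif_neg hσ)

lemma extendChain_injective {d : ℕ} :
    Function.Injective (extendChain : (K.Simplex d → ℝ) → Finset V → ℝ) := by
  intro x y h
  ext σ
  rw [← extendChain_coe x, h, extendChain_coe]

lemma extendChain_zero {d : ℕ} : extendChain (0 : K.Simplex d → ℝ) = 0 := by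
  ext σ
  by_contra h
  have h' := of_extendChain_ne_zero h
  exact h (dif_pos h')

lemma extendChain_smul {d : ℕ} (c : ℝ) (x : K.Simplex d → ℝ) :
    extendChain (c • x) = c • extendChain x := by
  ext σ
  by_cases h : σ ∈ K ∧ σ.card = d + 1
  · simp only [extendChain, dif_pos h, Pi.smul_apply]
    rfl
  · simp [extendChain, h]

lemma extendChain_add {d : ℕ} (x y : K.Simplex d → ℝ) :
    extendChain (x + y) = extendChain x + extendChain y := by
  ext σ
  by_cases h : σ ∈ K ∧ σ.card = d + 1
  · simp only [extendChain, dif_pos h, Pi.add_apply]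
    rfl
  · simp [extendChain, h]

lemma sum_mul_extendChain [Fintype V] {d : ℕ} (g : Finset V → ℝ) (x : K.Simplex d → ℝ) :
    ∑ σ, g σ * extendChain x σ = ∑ σ : K.Simplex d, g σ.1 * x σ := by
  classical
  symm
  refine sum_of_injOn (fun σ : K.Simplex d => σ.1) (fun σ _ τ _ h => Subtype.ext h) (by simp) ?_ ?_
  · intro σ _ hσ
    rw [extendChain, dif_neg, mul_zero]
    exact fun h => hσ ⟨⟨σ, h⟩, mem_coe.2 (mem_univ _), rfl⟩
  · intro σ _
    rw [extendChain_coe]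

variable [LinearOrder V]

lemma exists_of_boundaryCoeff_ne_zero {τ σ : Finset V} (h : boundaryCoeff τ σ ≠ 0) :
    ∃ v ∈ σ, τ = σ.erase v := by
  obtain ⟨v, hv, hne⟩ := exists_ne_zero_of_sum_ne_zero h
  exact ⟨v, hv, by by_contra hc; exact hne (if_neg hc)⟩

lemma card_of_boundaryCoeff_ne_zero {τ σ : Finset V} (h : boundaryCoeff τ σ ≠ 0) :
    σ.card = τ.card + 1 := by
  obtain ⟨v, hv, rfl⟩ := exists_of_boundaryCoeff_ne_zero h
  rw [card_erase_add_one hv]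

lemma subset_of_boundaryCoeff_ne_zero {τ σ : Finset V} (h : boundaryCoeff τ σ ≠ 0) : τ ⊆ σ := by
  obtain ⟨v, hv, rfl⟩ := exists_of_boundaryCoeff_ne_zero h
  exact erase_subset v σ

variable [Fintype V]

lemma augBoundary_mulVec_extendChain {d : ℕ} (x : K.Simplex (d + 1) → ℝ) :
    augBoundary K.AugFace *ᵥ extendChain x = extendChain (K.boundary d *ᵥ x) := by
  classical
  ext τ
  simp only [mulVec, dotProduct, augBoundary, of_apply]
  rw [sum_mul_extendChain (fun σ => if K.AugFace σ then boundaryCoeff τ σ else 0)]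
  have h1 : ∀ σ : K.Simplex (d + 1), K.AugFace σ.1 := fun σ => Or.inr σ.2.1
  simp only [h1, if_true]
  by_cases h : τ ∈ K ∧ τ.card = d + 1
  · rw [extendChain, dif_pos h]
    rfl
  · rw [extendChain, dif_neg h]
    refine sum_eq_zero fun σ _ => ?_
    by_contra hne
    have hc := left_ne_zero_of_mul hne
    have h2 := card_of_boundaryCoeff_ne_zero hc
    rw [σ.2.2] at h2
    have h3 : τ.card = d + 1 := by omega
    exact h ⟨(K.isRelLowerSet_faces σ.2.1).2 (subset_of_boundaryCoeff_ne_zero hc)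
      (card_pos.1 (by omega)), h3⟩

lemma augBoundary_transpose_mulVec_extendChain {d : ℕ} (x : K.Simplex d → ℝ) :
    (augBoundary K.AugFace)ᵀ *ᵥ extendChain x = extendChain ((K.boundary d)ᵀ *ᵥ x) := by
  classical
  ext σ
  simp only [mulVec, dotProduct, augBoundary, transpose_apply, of_apply]
  rw [sum_mul_extendChain (fun τ => if K.AugFace σ then boundaryCoeff τ σ else 0)]
  by_cases h : σ ∈ K ∧ σ.card = d + 1 + 1
  · rw [extendChain, dif_pos h]
    have h1 : K.AugFace σ := Or.inr h.1
    simp only [h1, if_true]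
    rfl
  · rw [extendChain, dif_neg h]
    refine sum_eq_zero fun τ _ => ?_
    by_contra hne
    have hc := left_ne_zero_of_mul hne
    have hσ : K.AugFace σ := by
      by_contra h1
      exact hc (if_neg h1)
    rw [if_pos hσ] at hc
    have h2 := card_of_boundaryCoeff_ne_zero hc
    rw [τ.2.2] at h2
    refine h ⟨hσ.resolve_left ?_, h2⟩
    rintro rfl
    simp at h2

lemma augLaplacian_mulVec_extendChain {d : ℕ} (x : K.Simplex (d + 1) → ℝ) :
    augLaplacian K.AugFace *ᵥ extendChain x = extendChain (K.laplacian (d + 1) *ᵥ x) := by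
  rw [augLaplacian, add_mulVec, ← mulVec_mulVec, ← mulVec_mulVec,
    augBoundary_mulVec_extendChain, augBoundary_transpose_mulVec_extendChain,
    augBoundary_mulVec_extendChain, augBoundary_transpose_mulVec_extendChain, add_comm,
    ← extendChain_add, AbstractSimplicialComplex.laplacian, add_mulVec, mulVec_mulVec,
    mulVec_mulVec]

/-- An eigenchain for a nonzero eigenvalue of `Δ_d` is an eigenchain of the augmented Laplacian.
For `d = 0` the two operators differ by `∂ᵀ ∂` with `∂` the augmentation map, which vanishes on the
image of the boundary map. The decidability instance is arbitrary, as it need not come from the order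
of the vertices. -/
lemma exists_augLaplacian_eigenvector {d : ℕ} [DecidableEq (K.Simplex d)] {μ : ℝ}
    (h : μ ∈ nonzeroEigenvalues (K.laplacian d)) :
    ∃ X : Finset V → ℝ, X ≠ 0 ∧ augLaplacian K.AugFace *ᵥ X = μ • X ∧
      ∀ σ, X σ ≠ 0 → σ ∈ K ∧ σ.card = d + 1 := by
  obtain ⟨hμ, hev⟩ := h
  obtain ⟨x, hx, hx0⟩ := hev.exists_hasEigenvector
  rw [Module.End.mem_eigenspace_iff, toLin'_apply] at hx
  refine ⟨extendChain x, ?_, ?_, fun σ => of_extendChain_ne_zero⟩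
  · intro h0
    exact hx0 (extendChain_injective (h0.trans extendChain_zero.symm))
  · cases d with
    | succ d => rw [augLaplacian_mulVec_extendChain, hx, extendChain_smul]
    | zero =>
      have h1 : augBoundary K.AugFace *ᵥ (augBoundary K.AugFace)ᵀ *ᵥ extendChain x =
          μ • extendChain x := by
        rw [augBoundary_transpose_mulVec_extendChain, augBoundary_mulVec_extendChain,
          ← extendChain_smul, ← hx, mulVec_mulVec]
        rfl
      have h2 : augBoundary K.AugFace *ᵥ extendChain x = 0 := by
        have h3 := congrArg (augBoundary K.AugFace *ᵥ ·) h1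
        simp only [mulVec_mulVec, ← mul_assoc] at h3
        rw [augBoundary_mul_self AbstractSimplicialComplex.AugFace.mono, Matrix.zero_mul,
          zero_mulVec, mulVec_smul] at h3
        exact (smul_eq_zero.1 h3.symm).resolve_left hμ
      rw [augLaplacian, add_mulVec, ← mulVec_mulVec, ← mulVec_mulVec, h1, h2, mulVec_zero, add_zero]

lemma mem_nonzeroEigenvalues_of_augLaplacian {d : ℕ} [DecidableEq (K.Simplex (d + 1))] {μ : ℝ}
    (hμ : μ ≠ 0) {X : Finset V → ℝ} (hX : X ≠ 0) (h : augLaplacian K.AugFace *ᵥ X = μ • X)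
    (hs : ∀ σ, X σ ≠ 0 → σ ∈ K ∧ σ.card = d + 2) :
    μ ∈ nonzeroEigenvalues (K.laplacian (d + 1)) := by
  classical
  have hext : X = extendChain fun σ : K.Simplex (d + 1) => X σ.1 := by
    ext σ
    by_cases hσ : σ ∈ K ∧ σ.card = d + 1 + 1
    · rw [extendChain, dif_pos hσ]
    · rw [extendChain, dif_neg hσ]
      by_contra h0
      exact hσ (hs σ h0)
  refine ⟨hμ, Module.End.hasEigenvalue_of_hasEigenvector
    (x := fun σ : K.Simplex (d + 1) => X σ.1) ⟨?_, ?_⟩⟩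
  · rw [Module.End.mem_eigenspace_iff, toLin'_apply]
    apply extendChain_injective
    rw [← augLaplacian_mulVec_extendChain, extendChain_smul, ← hext, h]
  · intro h0
    apply hX
    rw [hext, h0, extendChain_zero]

end SimplexChains

/-! ### Joins -/

section Blocks

section

variable {W : Type*}

/-- The parity of the number of vertices. -/
def paritySign (σ : Finset W) : ℝ := (-1) ^ σ.card

lemma paritySign_mul_self (σ : Finset W) : paritySign σ * paritySign σ = 1 := by
  rw [paritySign, ← mul_pow]; norm_num

lemma paritySign_mul_augBoundary [LinearOrder W] [Fintype W] (P : Finset W → Prop)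
    (σ τ : Finset W) :
    paritySign σ * paritySign τ * augBoundary P σ τ = -augBoundary P σ τ := by
  by_cases h : augBoundary P σ τ = 0
  · simp [h]
  · have h1 : boundaryCoeff σ τ ≠ 0 := by
      intro h0
      apply h
      simp [augBoundary, h0]
    have h2 : paritySign τ = -paritySign σ := by
      rw [paritySign, card_of_boundaryCoeff_ne_zero h1, pow_succ, paritySign]; ring
    rw [h2, mul_neg, paritySign_mul_self]
    ring

lemma factorOp_eq_mulVec {ι F : Type*} [LinearOrder ι] [Fintype F] (j : ι) (M : Matrix F F ℝ)
    (X : (ι → F) → ℝ)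
    (φ : ι → F) :
    factorOp j M X φ = (M *ᵥ fun τ => X (Function.update φ j τ)) (φ j) := rfl

end

variable {ι W V : Type*} [LinearOrder ι] [LinearOrder W] [Fintype W] [LinearOrder V]
  [Fintype V] (e : ι ×ₗ W ≃o V)

/-- When the vertices are ordered lexicographically in blocks indexed by `ι`, a set of vertices is
the same as a family of sets, one in each block. -/
def blocks : Finset V ≃ (ι → Finset W) where
  toFun σ j := univ.filter fun w => e (toLex (j, w)) ∈ σ
  invFun φ := univ.filter fun v => (ofLex (e.symm v)).2 ∈ φ (ofLex (e.symm v)).1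
  left_inv σ := by ext v; simp
  right_inv φ := by ext j w; simp

lemma mem_blocks {σ : Finset V} {j : ι} {w : W} :
    w ∈ blocks e σ j ↔ e (toLex (j, w)) ∈ σ := by
  simp [blocks]

lemma blocks_compl (σ : Finset V) (j : ι) : blocks e σᶜ j = (blocks e σ j)ᶜ := by
  ext w; simp [mem_blocks]

lemma blocks_erase (σ : Finset V) (j : ι) (w : W) :
    blocks e (σ.erase (e (toLex (j, w)))) =
      Function.update (blocks e σ) j ((blocks e σ j).erase w) := by
  ext i u
  by_cases h : i = j
  · subst h; simp [mem_blocks]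
  · simp [mem_blocks, h]

lemma blocks_insert (σ : Finset V) (j : ι) (w : W) :
    blocks e (insert (e (toLex (j, w))) σ) =
      Function.update (blocks e σ) j (insert w (blocks e σ j)) := by
  ext i u
  by_cases h : i = j
  · subst h; simp [mem_blocks]
  · simp [mem_blocks, h]

variable [Fintype ι]

lemma sum_eq_sum_blocks (σ : Finset V) (g : V → ℝ) :
    ∑ v ∈ σ, g v = ∑ j, ∑ w ∈ blocks e σ j, g (e (toLex (j, w))) := by
  have h1 : ∑ v ∈ σ, g v = ∑ v, if v ∈ σ then g v else 0 := by simp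
  rw [h1, ← e.toEquiv.sum_comp, ← Equiv.sum_comp toLex, Fintype.sum_prod_type]
  refine sum_congr rfl fun j _ => ?_
  exact (sum_filter _ _).symm

lemma card_eq_sum_blocks (σ : Finset V) : σ.card = ∑ j, (blocks e σ j).card := by
  have := sum_eq_sum_blocks e σ fun _ => 1
  simp only [sum_const, nsmul_eq_mul, mul_one] at this
  exact_mod_cast this

lemma vertexSign_eq_blocks (σ : Finset V) (j : ι) (w : W) :
    vertexSign σ (e (toLex (j, w))) =
      prefixSign paritySign j (blocks e σ) * vertexSign (blocks e σ j) w := by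
  have h1 : (σ.filter (· < e (toLex (j, w)))).card =
      ∑ i with i < j, (blocks e σ i).card + ((blocks e σ j).filter (· < w)).card := by
    have h2 : ∀ i, blocks e (σ.filter (· < e (toLex (j, w)))) i =
        if i < j then blocks e σ i else if i = j then (blocks e σ j).filter (· < w) else ∅ := by
      intro i
      ext u
      simp only [mem_blocks, mem_filter, OrderIso.lt_iff_lt, Prod.Lex.toLex_lt_toLex]
      split_ifs with h h'
      · simp [h, mem_blocks]
      · subst h'; simp [mem_blocks]
      · simp [h, h']
    rw [card_eq_sum_blocks e, sum_filter]
    have h3 : ((blocks e σ j).filter (· < w)).card =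
        ∑ i, if i = j then ((blocks e σ j).filter (· < w)).card else 0 := by simp
    rw [h3, ← sum_add_distrib]
    refine sum_congr rfl fun i _ => ?_
    rw [h2]
    split_ifs with h h'
    · exact absurd h' h.ne
    · simp
    · simp
    · simp
  rw [vertexSign, h1, pow_add, ← prod_pow_eq_pow_sum]
  rfl

variable {e} {P : Finset W → Prop} {Q : Finset V → Prop}

lemma augBoundary_mulVec_eq_blocks (hQ : ∀ σ, Q σ ↔ ∀ j, P (blocks e σ j)) {X : Finset V → ℝ}
    (hX : ∀ σ, X σ ≠ 0 → Q σ) :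
    (augBoundary Q *ᵥ X) ∘ (blocks e).symm =
      ∑ j, signedFactorOp paritySign j (augBoundary P) (X ∘ (blocks e).symm) := by
  classical
  ext φ
  obtain ⟨σ, rfl⟩ := (blocks e).surjective φ
  rw [Function.comp_apply, Equiv.symm_apply_apply, augBoundary_mulVec, sum_eq_sum_blocks e,
    Finset.sum_apply]
  refine sum_congr rfl fun j _ => ?_
  rw [signedFactorOp, factorOp_eq_mulVec, augBoundary_mulVec, mul_sum, blocks_compl]
  refine sum_congr rfl fun w _ => ?_
  rw [Function.comp_apply, ← blocks_insert, Equiv.symm_apply_apply, vertexSign_eq_blocks]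
  by_cases h : X (insert (e (toLex (j, w))) σ) = 0
  · simp [h]
  · have h1 := hX _ h
    have h2 := (hQ _).1 h1 j
    rw [blocks_insert, Function.update_self] at h2
    rw [if_pos h1, if_pos h2, mul_assoc]

lemma augBoundary_transpose_mulVec_eq_blocks (hQ : ∀ σ, Q σ ↔ ∀ j, P (blocks e σ j))
    {X : Finset V → ℝ} (hX : ∀ σ, X σ ≠ 0 → Q σ) :
    ((augBoundary Q)ᵀ *ᵥ X) ∘ (blocks e).symm =
      ∑ j, signedFactorOp paritySign j (augBoundary P)ᵀ (X ∘ (blocks e).symm) := by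
  classical
  ext φ
  obtain ⟨σ, rfl⟩ := (blocks e).surjective φ
  have h0 : ((augBoundary Q)ᵀ *ᵥ X) σ =
      ∑ v ∈ σ, if Q σ then vertexSign σ v * X (σ.erase v) else 0 := by
    rw [augBoundary_transpose_mulVec]
    split_ifs <;> simp
  rw [Function.comp_apply, Equiv.symm_apply_apply, h0, sum_eq_sum_blocks e,
    Finset.sum_apply]
  refine sum_congr rfl fun j _ => ?_
  have h0' : ∀ f : Finset W → ℝ, ((augBoundary P)ᵀ *ᵥ f) (blocks e σ j) =
      ∑ w ∈ blocks e σ j, if P (blocks e σ j) then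
        vertexSign (blocks e σ j) w * f ((blocks e σ j).erase w) else 0 := by
    intro f
    rw [augBoundary_transpose_mulVec]
    split_ifs <;> simp
  rw [signedFactorOp, factorOp_eq_mulVec, h0', mul_sum]
  refine sum_congr rfl fun w _ => ?_
  rw [Function.comp_apply, ← blocks_erase, Equiv.symm_apply_apply, vertexSign_eq_blocks]
  by_cases h : X (σ.erase (e (toLex (j, w)))) = 0
  · simp [h]
  · have h1 := (hQ _).1 (hX _ h)
    have h2 : Q σ ↔ P (blocks e σ j) := by
      rw [hQ]
      refine ⟨fun h => h j, fun h i => ?_⟩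
      by_cases hij : i = j
      · rwa [hij]
      · have := h1 i
        rwa [blocks_erase, Function.update_of_ne hij] at this
    simp only [h2]
    split_ifs
    · rw [mul_assoc]
    · simp

/-- The Laplacian of a join is the sum of the Laplacians of its factors. -/
lemma augLaplacian_mulVec_eq_blocks (hQmono : ∀ σ τ, τ ⊆ σ → Q σ → Q τ)
    (hQ : ∀ σ, Q σ ↔ ∀ j, P (blocks e σ j)) {X : Finset V → ℝ} (hX : ∀ σ, X σ ≠ 0 → Q σ) :
    (augLaplacian Q *ᵥ X) ∘ (blocks e).symm =
      ∑ j, factorOp j (augLaplacian P) (X ∘ (blocks e).symm) := by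
  classical
  have hodd := paritySign_mul_augBoundary P
  have hodd' : ∀ σ τ, paritySign σ * paritySign τ * (augBoundary P)ᵀ σ τ =
      -(augBoundary P)ᵀ σ τ := fun σ τ => by
    rw [transpose_apply, ← hodd]
    ring
  have h1 : ∀ σ, (augBoundary Q *ᵥ X) σ ≠ 0 → Q σ := by
    intro σ h
    by_contra hc
    rw [augBoundary_mulVec] at h
    exact h (sum_eq_zero fun v _ => if_neg fun h' => hc (hQmono _ _ (subset_insert _ _) h'))
  have h2 : ∀ σ, ((augBoundary Q)ᵀ *ᵥ X) σ ≠ 0 → Q σ := by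
    intro σ h
    by_contra hc
    rw [augBoundary_transpose_mulVec] at h
    exact h (if_neg hc)
  have h3 := sum_signedFactorOp_anticommutator paritySign_mul_self hodd hodd'
    (X ∘ (blocks e).symm)
  rw [← augBoundary_mulVec_eq_blocks hQ hX, ← augBoundary_transpose_mulVec_eq_blocks hQ hX,
    ← augBoundary_mulVec_eq_blocks hQ h2, ← augBoundary_transpose_mulVec_eq_blocks hQ h1] at h3
  refine Eq.trans ?_ h3
  rw [augLaplacian, add_mulVec, ← mulVec_mulVec, ← mulVec_mulVec]
  rfl

end Blocks

/-! ### Distances in the planar point set -/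

section PlanarGeometry

lemma dist_rotatedPoint_sq (φ a b ψ c d : ℝ) :
    dist (rotatedPoint φ a b) (rotatedPoint ψ c d) ^ 2 =
      a ^ 2 + b ^ 2 + c ^ 2 + d ^ 2 - 2 * Real.cos (φ - ψ) * (a * c + b * d) -
        2 * Real.sin (φ - ψ) * (a * d - b * c) := by
  rw [EuclideanSpace.dist_eq, Real.sq_sqrt (by positivity), Fin.sum_univ_two]
  simp only [rotatedPoint, Real.dist_eq, sq_abs, Real.cos_sub, Real.sin_sub]
  simp
  linear_combination (a ^ 2 + b ^ 2) * Real.sin_sq_add_cos_sq φ +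
    (c ^ 2 + d ^ 2) * Real.sin_sq_add_cos_sq ψ

/-- Directions that differ by a nontrivial multiple of `π / k` have an angle bounded away from
`0` and `π`. -/
lemma abs_cos_le_of_ne {k : ℕ} {i j : Fin k} (h : i ≠ j) :
    |Real.cos ((i : ℕ) * (Real.pi / k) - (j : ℕ) * (Real.pi / k))| ≤ 1 - 2 / (k : ℝ) ^ 2 := by
  wlog hij : j < i generalizing i j
  · have := this h.symm (lt_of_le_of_ne (not_lt.1 hij) h)
    rwa [← Real.cos_neg, neg_sub] at this
  have hk : (0 : ℝ) < k := by exact_mod_cast i.pos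
  have hij' : (j : ℝ) + 1 ≤ i := by exact_mod_cast hij
  have hik : (i : ℝ) + 1 ≤ k := by exact_mod_cast i.2
  have hj : (0 : ℝ) ≤ (j : ℕ) := Nat.cast_nonneg _
  have hpi := Real.pi_pos
  have hθ : 0 < Real.pi / k := by positivity
  have hkθ : (k : ℝ) * (Real.pi / k) = Real.pi := by field_simp
  set θ := Real.pi / k with hθdef
  set α := (i : ℕ) * θ - (j : ℕ) * θ with hα
  have h1 : θ ≤ α := by rw [hα]; nlinarith
  have h2 : α ≤ Real.pi - θ := by rw [hα]; nlinarith
  have key : ∀ β, θ ≤ β → β ≤ Real.pi → Real.cos β ≤ 1 - 2 / (k : ℝ) ^ 2 := by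
    intro β hβ1 hβ2
    have hβ0 : 0 < β := hθ.trans_le hβ1
    refine (Real.cos_le_one_sub_mul_cos_sq (abs_le.2 ⟨by linarith, hβ2⟩)).trans ?_
    have h3 : 2 / (k : ℝ) ^ 2 = 2 / Real.pi ^ 2 * θ ^ 2 := by
      rw [hθdef]; field_simp
    rw [h3]
    gcongr
  rw [abs_le]
  constructor
  · have := key (Real.pi - α) (by linarith) (by linarith)
    rw [Real.cos_pi_sub] at this
    linarith
  · exact key α h1 (by linarith)

/-- Points of clusters in different directions are distinct and at distance at most `1`: the heights
are at most `1 / (16 k²)`, too small to make up for the gap of order `1 / k²` that the angle leaves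
on both sides. -/
lemma dist_sq_of_ne {k : ℕ} {i j : Fin k} (h : i ≠ j) {a b c d : ℝ} (ha : a ^ 2 = (1 / 2) ^ 2)
    (hc : c ^ 2 = (1 / 2) ^ 2) (hb : |b| ≤ 1 / (16 * (k : ℝ) ^ 2))
    (hd : |d| ≤ 1 / (16 * (k : ℝ) ^ 2)) :
    let D := dist (rotatedPoint ((i : ℕ) * (Real.pi / k)) a b)
      (rotatedPoint ((j : ℕ) * (Real.pi / k)) c d) ^ 2
    0 < D ∧ D ≤ 1 := by
  intro D
  have hk : (1 : ℝ) ≤ k := by exact_mod_cast i.pos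
  have hk2 : (1 : ℝ) ≤ (k : ℝ) ^ 2 := one_le_pow₀ hk
  set η : ℝ := 1 / (k : ℝ) ^ 2 with hη
  have hη0 : 0 < η := by positivity
  have hη1 : η ≤ 1 := by rw [hη, div_le_one (by positivity)]; exact hk2
  have hβ : 1 / (16 * (k : ℝ) ^ 2) = η / 16 := by rw [hη]; field_simp
  have hC : |Real.cos ((i : ℕ) * (Real.pi / k) - (j : ℕ) * (Real.pi / k))| ≤ 1 - 2 * η := by
    refine (abs_cos_le_of_ne h).trans_eq ?_
    rw [hη]; ring
  have hS := Real.abs_sin_le_one ((i : ℕ) * (Real.pi / k) - (j : ℕ) * (Real.pi / k))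
  have hD : D = _ := dist_rotatedPoint_sq _ a b _ c d
  rw [hβ] at hb hd
  set C := Real.cos ((i : ℕ) * (Real.pi / k) - (j : ℕ) * (Real.pi / k))
  set S := Real.sin ((i : ℕ) * (Real.pi / k) - (j : ℕ) * (Real.pi / k))
  have ha' : |a| = 1 / 2 := by rw [← abs_of_pos (show (0 : ℝ) < 1 / 2 by norm_num)]; exact
    (sq_eq_sq_iff_abs_eq_abs _ _).1 ha
  have hc' : |c| = 1 / 2 := by rw [← abs_of_pos (show (0 : ℝ) < 1 / 2 by norm_num)]; exact
    (sq_eq_sq_iff_abs_eq_abs _ _).1 hc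
  have h1 : |a * c + b * d| ≤ 1 / 4 + η / 256 := by
    refine (abs_add_le _ _).trans ?_
    rw [abs_mul, abs_mul, ha', hc']
    have : |b| * |d| ≤ η / 16 * (η / 16) := mul_le_mul hb hd (abs_nonneg _) (by positivity)
    nlinarith
  have h2 : |a * d - b * c| ≤ η / 16 := by
    refine (abs_sub _ _).trans ?_
    rw [abs_mul, abs_mul, ha', hc']
    linarith
  have h3 : |C * (a * c + b * d)| ≤ (1 - 2 * η) * (1 / 4 + η / 256) := by
    rw [abs_mul]
    exact mul_le_mul hC h1 (abs_nonneg _) ((abs_nonneg _).trans hC)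
  have h4 : |S * (a * d - b * c)| ≤ η / 16 := by
    rw [abs_mul]
    calc |S| * |a * d - b * c| ≤ 1 * (η / 16) := mul_le_mul hS h2 (abs_nonneg _) zero_le_one
      _ = η / 16 := one_mul _
  have hb2 : b ^ 2 ≤ η / 256 := by
    rw [← sq_abs]; nlinarith [abs_nonneg b]
  have hd2 : d ^ 2 ≤ η / 256 := by
    rw [← sq_abs]; nlinarith [abs_nonneg d]
  rw [abs_le] at h3 h4
  rw [hD, ha, hc]
  constructor
  · nlinarith [sq_nonneg b, sq_nonneg d]
  · nlinarith

lemma height_bound {k m : ℕ} (hk : 1 ≤ k) (i : Fin m) :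
    |((i : ℕ) + 1 : ℝ) * ((2 * k * m : ℝ) ^ 4)⁻¹| ≤ 1 / (16 * (k : ℝ) ^ 2) := by
  have hm : (1 : ℝ) ≤ m := by exact_mod_cast i.pos
  have hk' : (1 : ℝ) ≤ k := by exact_mod_cast hk
  have hi : ((i : ℕ) + 1 : ℝ) ≤ m := by exact_mod_cast i.2
  rw [abs_of_nonneg (by positivity), ← div_eq_mul_inv, div_le_div_iff₀ (by positivity)
    (by positivity), one_mul]
  have h1 : (k : ℝ) ^ 2 ≤ (k : ℝ) ^ 4 := pow_le_pow_right₀ hk' (by norm_num)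
  have h2 : (m : ℝ) ≤ (m : ℝ) ^ 4 := le_self_pow₀ hm (by norm_num)
  calc ((i : ℕ) + 1 : ℝ) * (16 * (k : ℝ) ^ 2) ≤ (m : ℝ) ^ 4 * (16 * (k : ℝ) ^ 4) :=
        mul_le_mul (hi.trans h2) (by gcongr) (by positivity) (by positivity)
    _ = (2 * k * m : ℝ) ^ 4 := by ring

lemma sign_half_sq (s : ℕ) : ((-1 : ℝ) ^ s * (1 / 2)) ^ 2 = (1 / 2) ^ 2 := by
  rw [mul_pow, ← pow_mul, pow_mul', neg_one_sq, one_pow, one_mul]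

lemma dist_planarPoint_sq_same (k m : ℕ) (j : Fin k) (s t : Fin 2) (i l : Fin m) :
    dist (planarPoint k m (toLex (j, toLex (s, i)))) (planarPoint k m (toLex (j, toLex (t, l)))) ^ 2
      = (if s = t then 0 else 1) +
        (((i : ℕ) : ℝ) - (l : ℕ)) ^ 2 * (((2 * k * m : ℝ) ^ 4)⁻¹) ^ 2 := by
  simp only [planarPoint, ofLex_toLex]
  rw [dist_rotatedPoint_sq, sub_self, Real.cos_zero, Real.sin_zero]
  fin_cases s <;> fin_cases t <;> simp <;> ring

lemma scale_pos {k m : ℕ} (hk : 1 ≤ k) (hm : 0 < m) : 0 < (((2 * k * m : ℝ) ^ 4)⁻¹) ^ 2 := by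
  have hm' : (0 : ℝ) < m := by exact_mod_cast hm
  have hk' : (0 : ℝ) < k := by exact_mod_cast hk
  positivity

/-- Two points of the planar set are at distance at most `1` unless they lie in opposite clusters
and have different heights there. -/
lemma dist_planarPoint_le_one {k m : ℕ} (hk : 1 ≤ k) (j j' : Fin k) (s t : Fin 2) (i l : Fin m) :
    dist (planarPoint k m (toLex (j, toLex (s, i)))) (planarPoint k m (toLex (j', toLex (t, l))))
      ≤ 1 ↔ (j = j' → s ≠ t → i = l) := by
  rw [← sq_le_one_iff₀ dist_nonneg]
  by_cases hj : j = j'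
  · subst hj
    rw [dist_planarPoint_sq_same]
    have hpos := scale_pos (k := k) hk i.pos
    by_cases hst : s = t
    · simp only [hst, if_true, zero_add, ne_eq, not_true_eq_false, false_imp_iff, imp_true_iff,
        iff_true]
      have h1 := abs_le.1 (height_bound hk i)
      have h2 := abs_le.1 (height_bound hk l)
      have hk2 : 1 / (16 * (k : ℝ) ^ 2) ≤ 1 / 2 := by
        have : (1 : ℝ) ≤ (k : ℝ) ^ 2 := one_le_pow₀ (by exact_mod_cast hk)
        exact one_div_le_one_div_of_le (by norm_num) (by linarith)
      rw [← mul_pow, sq_le_one_iff_abs_le_one, abs_le]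
      constructor <;> linarith
    · simp only [hst, if_false, ne_eq, not_false_eq_true, true_imp_iff, add_le_iff_nonpos_right]
      constructor
      · intro h
        have h1 : (((i : ℕ) : ℝ) - (l : ℕ)) ^ 2 = 0 :=
          le_antisymm (nonpos_of_mul_nonpos_left h hpos) (sq_nonneg _)
        have h2 : ((i : ℕ) : ℝ) = (l : ℕ) := sub_eq_zero.1 (pow_eq_zero_iff two_ne_zero |>.1 h1)
        exact Fin.ext (by exact_mod_cast h2)
      · rintro rfl
        simp
  · simp only [hj, false_imp_iff, iff_true]
    exact (dist_sq_of_ne hj (sign_half_sq s) (sign_half_sq t) (height_bound hk i)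
      (height_bound hk l)).2

lemma planarPoint_injective {k m : ℕ} (hk : 1 ≤ k) : Function.Injective (planarPoint k m) := by
  intro v w h
  induction v using Lex.rec with | _ v
  induction w using Lex.rec with | _ w
  obtain ⟨j, v⟩ := v
  obtain ⟨j', w⟩ := w
  induction v using Lex.rec with | _ v
  induction w using Lex.rec with | _ w
  obtain ⟨s, i⟩ := v
  obtain ⟨t, l⟩ := w
  have h0 : dist (planarPoint k m (toLex (j, toLex (s, i))))
      (planarPoint k m (toLex (j', toLex (t, l)))) ^ 2 = 0 := by
    rw [h]; simp
  by_cases hj : j = j'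
  · subst hj
    rw [dist_planarPoint_sq_same] at h0
    have hpos := scale_pos (k := k) hk i.pos
    by_cases hst : s = t
    · subst hst
      simp only [if_true, zero_add] at h0
      have h1 := (mul_eq_zero.1 h0).resolve_right hpos.ne'
      have h2 : ((i : ℕ) : ℝ) = (l : ℕ) := sub_eq_zero.1 (pow_eq_zero_iff two_ne_zero |>.1 h1)
      have h3 : i = l := Fin.ext (by exact_mod_cast h2)
      rw [h3]
    · rw [if_neg hst] at h0
      have := mul_nonneg (sq_nonneg (((i : ℕ) : ℝ) - (l : ℕ))) hpos.le
      linarith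
  · exact absurd h0 (dist_sq_of_ne hj (sign_half_sq s) (sign_half_sq t) (height_bound hk i)
      (height_bound hk l)).1.ne'

end PlanarGeometry

/-! ### Spectrum of a join of blocks -/

section JoinSpectrum

variable {k m : ℕ} {V : Type*} [LinearOrder V] [Fintype V] {K : AbstractSimplicialComplex V}
  {e : (Fin k ×ₗ Fin 2 ×ₗ Fin m) ≃o V}

/-- A nonzero eigenvalue of `Δ_d` is a sum of eigenvalues of the block, in degrees `n j - 1` with
`∑ j, n j = d + 1`. -/
lemma exists_of_mem_nonzeroEigenvalues (hK : ∀ σ, K.AugFace σ ↔ ∀ j, BlockFace (blocks e σ j))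
    {d : ℕ} [DecidableEq (K.Simplex d)] {μ : ℝ} (h : μ ∈ nonzeroEigenvalues (K.laplacian d)) :
    ∃ (n : Fin k → ℕ) (c : Fin k → ℝ), ∑ j, n j = d + 1 ∧ ∑ j, c j = μ ∧ ∀ j,
      (n j = 0 ∧ c j = 2 * m) ∨ (n j = 1 ∧ (c j = 2 ∨ c j = m ∨ c j = m + 2 ∨ c j = 2 * m)) ∨
      (2 ≤ n j ∧ (c j = 0 ∨ c j = 2 ∨ c j = m ∨ c j = m + 2 ∨ c j = 2 * m)) := by
  obtain ⟨X, hX0, hX, hsupp⟩ := exists_augLaplacian_eigenvector h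
  have hjoin := augLaplacian_mulVec_eq_blocks AbstractSimplicialComplex.AugFace.mono
    hK fun σ hσ => Or.inr (hsupp σ hσ).1
  rw [hX] at hjoin
  have hX0' : X ∘ (blocks e).symm ≠ 0 := by
    intro h0
    apply hX0
    ext σ
    simpa using congrFun h0 (blocks e σ)
  obtain ⟨φ, c, f, hφ, hf, hfφ, hc⟩ := exists_eigenvectors_of_sum_factorOp
    (augLaplacian_isHermitian _) hX0' (μ := μ) hjoin.symm
  obtain ⟨σ, rfl⟩ := (blocks e).surjective φ
  rw [Function.comp_apply, Equiv.symm_apply_apply] at hφ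
  obtain ⟨hσ, hcard⟩ := hsupp σ hφ
  exact ⟨fun j => (blocks e σ j).card, c,
    by rw [← hcard, card_eq_sum_blocks e], hc, fun j =>
      blockEigenvalue (hf j) ((hK σ).1 (Or.inr hσ) j) (hfφ j)⟩

/-- Eigenvectors of the block multiply to an eigenchain of the join. -/
lemma sum_mem_nonzeroEigenvalues (hK : ∀ σ, K.AugFace σ ↔ ∀ j, BlockFace (blocks e σ j))
    {d : ℕ} [DecidableEq (K.Simplex (d + 1))] {n : Fin k → ℕ} {c : Fin k → ℝ}
    (hn : ∑ j, n j = d + 2) (hc : ∑ j, c j ≠ 0)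
    (h : ∀ j, ∃ f : Finset (Fin 2 ×ₗ Fin m) → ℝ, f ≠ 0 ∧ augLaplacian BlockFace *ᵥ f = c j • f ∧
      ∀ σ, f σ ≠ 0 → BlockFace σ ∧ σ.card = n j) :
    ∑ j, c j ∈ nonzeroEigenvalues (K.laplacian (d + 1)) := by
  choose f hf0 hf hsupp using h
  set X : Finset V → ℝ := fun σ => ∏ j, f j (blocks e σ j) with hXdef
  have hXsupp : ∀ σ, X σ ≠ 0 → K.AugFace σ ∧ σ.card = d + 2 := by
    intro σ hσ
    have h1 := fun j => prod_ne_zero_iff.1 hσ j (mem_univ j)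
    refine ⟨(hK σ).2 fun j => (hsupp j _ (h1 j)).1, ?_⟩
    rw [card_eq_sum_blocks e, ← hn]
    exact sum_congr rfl fun j _ => (hsupp j _ (h1 j)).2
  have hcomp : X ∘ (blocks e).symm = fun φ => ∏ j, f j (φ j) := by
    ext φ
    simp [hXdef]
  have hjoin := augLaplacian_mulVec_eq_blocks AbstractSimplicialComplex.AugFace.mono
    hK fun σ hσ => (hXsupp σ hσ).1
  rw [hcomp, sum_factorOp_prod _ f hf, ← hcomp] at hjoin
  refine mem_nonzeroEigenvalues_of_augLaplacian hc (X := X) ?_ ?_ fun σ hσ => ?_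
  · choose τ hτ using fun j => Function.ne_iff.1 (hf0 j)
    intro h0
    have := congrFun h0 ((blocks e).symm τ)
    simp only [hXdef, Equiv.apply_symm_apply, Pi.zero_apply] at this
    exact prod_ne_zero_iff.2 (fun j _ => hτ j) this
  · ext σ
    simpa using congrFun hjoin (blocks e σ)
  · obtain ⟨h1, h2⟩ := hXsupp σ hσ
    refine ⟨h1.resolve_left ?_, h2⟩
    rintro rfl
    simp at h2

end JoinSpectrum

/-! ### The Rips complex as a join -/

section PlanarJoin

variable {k m : ℕ}

/-- The labelling of the planar set is an isomorphism of orders. -/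
lemma exists_planarLabel (hk : 1 ≤ k) :
    ∃ e : (Fin k ×ₗ Fin 2 ×ₗ Fin m) ≃o planarSet k m,
      ∀ v, (e v : EuclideanSpace ℝ (Fin 2)) = planarPoint k m v := by
  let e := Equiv.ofInjective (planarPoint k m) (planarPoint_injective hk)
  have h : ∀ v, Set.rangeSplitting (planarPoint k m) (e v) = v := fun v =>
    planarPoint_injective hk (Set.apply_rangeSplitting (planarPoint k m) (e v))
  refine ⟨⟨e, fun {v w} => ?_⟩, fun v => rfl⟩
  have h1 : (Set.rangeSplitting (planarPoint k m) (e v) ≤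
      Set.rangeSplitting (planarPoint k m) (e w)) ↔ v ≤ w := by rw [h, h]
  exact h1

/-- The Rips complex is the join of `k` copies of the block. -/
lemma augFace_planarRips_iff [Fintype (planarSet k m)] (hk : 1 ≤ k)
    {e : (Fin k ×ₗ Fin 2 ×ₗ Fin m) ≃o planarSet k m}
    (he : ∀ v, (e v : EuclideanSpace ℝ (Fin 2)) = planarPoint k m v)
    (σ : Finset (planarSet k m)) :
    (planarRips k m).AugFace σ ↔ ∀ j, BlockFace (blocks e σ j) := by
  have h1 : (planarRips k m).AugFace σ ↔
      (σ : Set (planarSet k m)).Pairwise fun x y => dist x y ≤ 1 := by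
    constructor
    · rintro (rfl | h)
      · simp
      · exact h.2
    · intro h
      rcases σ.eq_empty_or_nonempty with h0 | h0
      · exact Or.inl h0
      · exact Or.inr ⟨h0, h⟩
  have hdist : ∀ (j j' : Fin k) (u v : Fin 2 ×ₗ Fin m),
      dist (e (toLex (j, u))) (e (toLex (j', v))) ≤ 1 ↔
        (j = j' → (ofLex u).1 ≠ (ofLex v).1 → (ofLex u).2 = (ofLex v).2) := by
    intro j j' u v
    rw [Subtype.dist_eq, he, he]
    exact dist_planarPoint_le_one hk j j' _ _ _ _
  rw [h1]
  constructor
  · intro h j u hu v hv hne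
    rw [mem_blocks] at hu hv
    refine (hdist j j u v).1 (h hu hv fun huv => hne ?_) rfl hne
    have := congrArg ofLex (e.injective huv)
    simp only [ofLex_toLex, Prod.mk.injEq, true_and] at this
    rw [this]
  · intro h x hx y hy _
    obtain ⟨v, rfl⟩ := e.surjective x
    obtain ⟨w, rfl⟩ := e.surjective y
    refine (hdist (ofLex v).1 (ofLex w).1 (ofLex v).2 (ofLex w).2).2 fun hj hs => ?_
    refine h (ofLex v).1 (ofLex v).2 ?_ (ofLex w).2 ?_ hs
    · rw [mem_blocks]; exact hx
    · rw [mem_blocks, hj]; exact hy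

end PlanarJoin

end

/-! ### The spectral gap -/

open Finset in
theorem proposition4 :
    ∃ c : ℝ, 0 < c ∧ ∀ k : ℕ, 1 ≤ k →
      (∀ m : ℕ, 1 ≤ m → ∀ d : ℕ,
        ∀ μ ∈ nonzeroEigenvalues ((planarRips k m).laplacian d), c ≤ μ) ∧
      (∀ d : ℕ, k ≤ d → d ≤ 2 * k - 1 →
        ∃ l : ℝ, ∀ m : ℕ, 2 ≤ m → IsSpectralGap ((planarRips k m).laplacian d) l) := by
  have hsum : ∀ {k : ℕ} {c : Fin k → ℝ} {b : ℝ}, 0 ≤ b → (∀ j, c j = 0 ∨ b ≤ c j) →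
      ∑ j, c j ≠ 0 → b ≤ ∑ j, c j := by
    intro k c b hb hc hne
    obtain ⟨j, -, hj⟩ := exists_ne_zero_of_sum_ne_zero hne
    refine ((hc j).resolve_left hj).trans (single_le_sum (fun i _ => ?_) (mem_univ j))
    rcases hc i with h | h
    · exact h.ge
    · exact hb.trans h
  refine ⟨1, one_pos, fun k hk => ⟨fun m hm d μ hμ => ?_, fun d hkd hdk => ?_⟩⟩
  · have hm' : (1 : ℝ) ≤ m := by exact_mod_cast hm
    have := Fintype.ofFinite (planarSet k m)
    obtain ⟨e, he⟩ := exists_planarLabel (m := m) hk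
    obtain ⟨n, c, -, rfl, hnc⟩ :=
      exists_of_mem_nonzeroEigenvalues (augFace_planarRips_iff hk he) hμ
    refine hsum zero_le_one (fun j => ?_) hμ.1
    by_cases h0 : c j = 0
    · exact Or.inl h0
    · right
      rcases hnc j with ⟨-, h⟩ | ⟨-, h | h | h | h⟩ | ⟨-, h | h | h | h | h⟩
      all_goals first | exact absurd h h0 | linarith
  · obtain ⟨t, ht⟩ : ∃ t, d + 1 + t = 2 * k := ⟨2 * k - (d + 1), by omega⟩
    obtain ⟨d, rfl⟩ : ∃ d', d = d' + 1 := ⟨d - 1, by omega⟩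
    have htk : max 1 t ≤ k := by omega
    refine ⟨2 * (max 1 t : ℕ), fun m hm => ⟨?_, fun μ hμ => ?_⟩⟩
    -- the first `max 1 t` blocks carry the eigenvalue `2`, the others a harmonic chain
    · have := Fintype.ofFinite (planarSet k m)
      obtain ⟨e, he⟩ := exists_planarLabel (m := m) hk
      have hcount : (univ.filter fun j : Fin k => (j : ℕ) < max 1 t).card = max 1 t := by
        rw [Fin.card_filter_val_lt]
        omega
      have hc : ∑ j : Fin k, (if (j : ℕ) < max 1 t then (2 : ℝ) else 0) = 2 * (max 1 t : ℕ) := by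
        rw [← sum_filter, sum_const, hcount, nsmul_eq_mul, mul_comm]
      rw [← hc]
      refine sum_mem_nonzeroEigenvalues (augFace_planarRips_iff hk he)
        (n := fun j => if (j : ℕ) < max 1 t ∧ t ≠ 0 then 1 else 2) ?_ ?_ fun j => ?_
      · by_cases h0 : t = 0
        · simp [h0]
          omega
        · simp only [ne_eq, h0, not_false_eq_true, and_true]
          rw [sum_ite, sum_const, sum_const, hcount, filter_not, card_sdiff_of_subset
            (filter_subset _ _), hcount, card_univ, Fintype.card_fin, smul_eq_mul, smul_eq_mul]
          omega
      · rw [hc]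
        positivity
      · by_cases hj : (j : ℕ) < max 1 t
        · by_cases h0 : t = 0
          · rw [if_pos hj, if_neg fun h => h.2 h0]
            exact exists_blockEigenvector_edges (by omega)
          · rw [if_pos hj, if_pos ⟨hj, h0⟩]
            exact exists_blockEigenvector_vertices (by omega)
        · rw [if_neg hj, if_neg fun h => hj h.1]
          exact exists_blockEigenvector_harmonic hm
    · have hm' : (2 : ℝ) ≤ m := by exact_mod_cast hm
      have := Fintype.ofFinite (planarSet k m)
      obtain ⟨e, he⟩ := exists_planarLabel (m := m) hk
      obtain ⟨n, c, hn, rfl, hnc⟩ :=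
        exists_of_mem_nonzeroEigenvalues (augFace_planarRips_iff hk he) hμ
      have h2 : 2 ≤ ∑ j, c j := by
        refine hsum zero_le_two (fun j => ?_) hμ.1
        by_cases h0 : c j = 0
        · exact Or.inl h0
        · right
          rcases hnc j with ⟨-, h⟩ | ⟨-, h | h | h | h⟩ | ⟨-, h | h | h | h | h⟩
          all_goals first | exact absurd h h0 | linarith
      -- lowering the degree of a block below one costs an eigenvalue `2` for each step
      have ht2 : 2 * (t : ℝ) ≤ ∑ j, c j := by
        have hj : ∀ j, 4 - 2 * (n j : ℝ) ≤ c j := by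
          intro j
          rcases hnc j with ⟨hn, h⟩ | ⟨hn, h⟩ | ⟨hn, h⟩
          · rw [hn, h]; norm_num; linarith
          · rw [hn]
            rcases h with h | h | h | h <;> push_cast <;> linarith
          · have hn' : (2 : ℝ) ≤ n j := by exact_mod_cast hn
            rcases h with h | h | h | h | h <;> rw [h] <;> linarith
        have hle := sum_le_sum fun j (_ : j ∈ univ) => hj j
        rw [sum_sub_distrib, sum_const, card_univ, Fintype.card_fin, nsmul_eq_mul, ← mul_sum] at hle
        have hn' : ∑ j, (n j : ℝ) = d + 1 + 1 := by exact_mod_cast hn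
        have ht' : (d : ℝ) + 1 + 1 + t = 2 * k := by exact_mod_cast ht
        linarith
      rcases Nat.le_total t 1 with h | h
      · rw [max_eq_left h]; simpa using h2
      · rw [max_eq_right h]; exact ht2
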